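/- Let $m_1\ge m_2\ge\dots\ge m_n$ be integers. A Gelfand–Tsetlin pattern with top row $m$ is a triangular array of integers $\xi=(m_{i,k})_{1\le i\le k\le n}$ with $m_{i,n}=m_i$ and $m_{i,k+1}\ge m_{i,k}\ge m_{i+1,k+1}$ for $1\le i\le k<n$. Let $R$ be the complex vector space whose basis is the set of these patterns, and put $l_{i,k}=m_{i,k}-i$. For $2\le k\le n$ define operators on $R$ by $$E_{k-1,k}\,\xi=\sum_{j=1}^{k-1}a^j_{k-1,k}(\xi)\,\xi^{+j},\qquad a^j_{k-1,k}(\xi)=\left[-\frac{\prod_{i=1}^{k}(l_{i,k}-l_{j,k-1})\prod_{i=1}^{k-2}(l_{i,k-2}-l_{j,k-1}-1)}{\prod_{i\ne j}(l_{i,k-1}-l_{j,k-1})(l_{i,k-1}-l_{j,k-1}-1)}\right]^{1/2},$$ $$F_{k,k-1}\,\xi=\sum_{j=1}^{k-1}b^j_{k,k-1}(\xi)\,\xi^{-j},\qquad b^j_{k,k-1}(\xi)=\left[-\frac{\prod_{i=1}^{k}(l_{i,k}-l_{j,k-1}+1)\prod_{i=1}^{k-2}(l_{i,k-2}-l_{j,k-1})}{\prod_{i\ne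 j}(l_{i,k-1}-l_{j,k-1}+1)(l_{i,k-1}-l_{j,k-1})}\right]^{1/2},$$ where $\prod_{i\neq j}$ runs over $1\le i\le k-1$, $i\ne j$, the array $\xi^{\pm j}$ is obtained from $\xi$ by replacing $m_{j,k-1}$ with $m_{j,k-1}\pm1$, the terms for which $\xi^{\pm j}$ is not a pattern are omitted, and the nonnegative square root is taken; for $1\le k\le n$ let $$H_{k,k}\,\xi=\Big(\sum_{i=1}^{k}m_{i,k}-\sum_{i=1}^{k-1}m_{i,k-1}\Big)\xi .$$ Let $\beta\in R$ be the pattern with $m_{i,k}=m_i$ for all $i\le k$. Then $R$ carries the structure of an $sl_n(\mathbb C)$-module in which the matrix units $E_{k-1,k}$ and $E_{k,k-1}$ act by the operators $E_{k-1,k}$ and $F_{k,k-1}$ above ($2\le k\le n$), and the diagonal matrices $H_{k,k}-H_{k+1,k+1}$ act as the differences of the operators above ($1\le k<n$). This module is simple. Moreover: 1. $\beta$ is a highest weight vector: it is nonzero, it is a common eigenvector of all diagonal matrices in $sl_n$, and it is annihilated by all $E_{i,j}$ with $i<j$. 2. For every nonzero $v=\sum_\alpha a_\alpha\alpha\in R$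 (a linear combination of patterns $\alpha$) there are a finite (possibly empty) product $T$ of operators $E_{i,i+1}$, a pattern $\alpha_0$ with $a_{\alpha_0}\ne0$ and a number $c\neq0$ such that $T\alpha_0=c\beta$, $T\alpha=0$ for every other pattern $\alpha$ with $a_\alpha\neq0$, and hence $Tv=a_{\alpha_0}c\,\beta\ne0$. 3. $\beta$ generates $R$ under the lowering operators: the vectors $T\beta$, with $T$ a finite (possibly empty) product of operators $F_{i+1,i}$, span $R$. -/

import Mathlib

/-- `p` is a Gelfand–Tsetlin pattern with top row `m`.  The entry of row `k` (`1 ≤ k ≤ n`) at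
position `i` (`0 ≤ i < k`, counted from `0`) is `p k i`; row `n` is `m`, consecutive rows
interlace, and the values outside the triangle are `0` by convention. -/
structure IsGTPattern {n : ℕ} (m : Fin n → ℤ) (p : ℕ → ℕ → ℤ) : Prop where
  top_row : ∀ i : Fin n, p n i = m i
  le_upper : ∀ k i, k < n → i < k → p k i ≤ p (k + 1) i
  lower_le : ∀ k i, k < n → i < k → p (k + 1) (i + 1) ≤ p k i
  zeros : ∀ k i, n < k ∨ k ≤ i → p k i = 0

/-- The Gelfand–Tsetlin patterns with top row `m`. -/
abbrev GTPattern {n : ℕ} (m : Fin n → ℤ) : Type := {p : ℕ → ℕ → ℤ // IsGTPattern m p}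

/-- The complex vector space with basis the Gelfand–Tsetlin patterns with top row `m`. -/
abbrev GTSpace {n : ℕ} (m : Fin n → ℤ) : Type := GTPattern m →₀ ℂ

/-- The array obtained from `p` by adding `d` to the entry of row `k` at position `j`. -/
def gtShift (p : ℕ → ℕ → ℤ) (k j : ℕ) (d : ℤ) : ℕ → ℕ → ℤ :=
  fun k' j' => if k' = k ∧ j' = j then p k' j' + d else p k' j'

/-- The shifted entries `l_{i,k} = p_{i,k} - i`.  Only differences of these numbers are used, so it
does not matter that positions are counted from `0`. -/
def gtL (p : ℕ → ℕ → ℤ) (k i : ℕ) : ℝ := (p k i : ℝ) - (i : ℝ)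

/-- The coefficient with which raising row `k` at position `j` occurs in the action on `p`. -/
noncomputable def gtRaiseCoeff (p : ℕ → ℕ → ℤ) (k j : ℕ) : ℝ :=
  Real.sqrt (-((∏ i ∈ Finset.range (k + 1), (gtL p (k + 1) i - gtL p k j)) *
      (∏ i ∈ Finset.range (k - 1), (gtL p (k - 1) i - gtL p k j - 1))) /
    ∏ i ∈ (Finset.range k).erase j, ((gtL p k i - gtL p k j) * (gtL p k i - gtL p k j - 1)))

/-- The coefficient with which lowering row `k` at position `j` occurs in the action on `p`. -/
noncomputable def gtLowerCoeff (p : ℕ → ℕ → ℤ) (k j : ℕ) : ℝ :=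
  Real.sqrt (-((∏ i ∈ Finset.range (k + 1), (gtL p (k + 1) i - gtL p k j + 1)) *
      (∏ i ∈ Finset.range (k - 1), (gtL p (k - 1) i - gtL p k j))) /
    ∏ i ∈ (Finset.range k).erase j, ((gtL p k i - gtL p k j + 1) * (gtL p k i - gtL p k j)))

open Classical in
/-- The basis vector of the array `p`, with the convention that it is `0` if `p` is not a pattern. -/
noncomputable def gtVec {n : ℕ} (m : Fin n → ℤ) (p : ℕ → ℕ → ℤ) : GTSpace m :=
  if h : IsGTPattern m p then Finsupp.single ⟨p, h⟩ 1 else 0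

/-- The raising operator of row `k`, for `1 ≤ k < n`: it sends a pattern to the sum, over the
positions `j` of row `k`, of the raising coefficient times the pattern with that entry raised. -/
noncomputable def gtRaise {n : ℕ} (m : Fin n → ℤ) (k : ℕ) : GTSpace m →ₗ[ℂ] GTSpace m :=
  Finsupp.linearCombination ℂ fun ξ : GTPattern m =>
    ∑ j ∈ Finset.range k, (gtRaiseCoeff ξ.1 k j : ℂ) • gtVec m (gtShift ξ.1 k j 1)

/-- The lowering operator of row `k`, for `1 ≤ k < n`. -/
noncomputable def gtLower {n : ℕ} (m : Fin n → ℤ) (k : ℕ) : GTSpace m →ₗ[ℂ] GTSpace m :=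
  Finsupp.linearCombination ℂ fun ξ : GTPattern m =>
    ∑ j ∈ Finset.range k, (gtLowerCoeff ξ.1 k j : ℂ) • gtVec m (gtShift ξ.1 k j (-1))

/-- The eigenvalue on the pattern `p` of the diagonal matrix unit with (`0`-based) index `i`: the sum
of row `i + 1` minus the sum of row `i`. -/
def gtWeight (p : ℕ → ℕ → ℤ) (i : ℕ) : ℤ :=
  (∑ j ∈ Finset.range (i + 1), p (i + 1) j) - ∑ j ∈ Finset.range i, p i j

/-- The diagonal operator of the matrix unit with (`0`-based) index `i`. -/
noncomputable def gtDiag {n : ℕ} (m : Fin n → ℤ) (i : ℕ) : GTSpace m →ₗ[ℂ] GTSpace m :=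
  Finsupp.linearCombination ℂ fun ξ : GTPattern m => Finsupp.single ξ (gtWeight ξ.1 i : ℂ)

/-- The special linear Lie algebra of traceless complex `n × n` matrices. -/
abbrev SLn (n : ℕ) : Type := LieAlgebra.SpecialLinear.sl (Fin n) ℂ

/-- The matrix unit `E_{i,j}`, `i ≠ j`, as an element of `sl_n`. -/
def slUnit {n : ℕ} (i j : Fin n) (h : i ≠ j) : SLn n :=
  LieAlgebra.SpecialLinear.single i j h 1

/-- The diagonal matrix `H_{i,i} - H_{j,j}` as an element of `sl_n`. -/
def slDiag {n : ℕ} (i j : Fin n) : SLn n :=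
  LieAlgebra.SpecialLinear.singleSubSingle i j 1

/-- An action of `sl_n` on the space of patterns is the Gelfand–Tsetlin action if the matrices
`E_{i,i+1}`, `E_{i+1,i}` and `H_{i,i} - H_{i+1,i+1}` (which generate `sl_n`) act by the
Gelfand–Tsetlin formulas.  With `0`-based indices `i` and `j = i + 1`, the row that is changed by
`E_{i,j}` and `E_{j,i}` is the one with `j` entries. -/
structure IsGTAction {n : ℕ} (m : Fin n → ℤ) [LieRingModule (SLn n) (GTSpace m)] : Prop where
  raise : ∀ (i j : Fin n) (h : i ≠ j), (i : ℕ) + 1 = j →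
    ∀ v : GTSpace m, ⁅slUnit i j h, v⁆ = gtRaise m j v
  lower : ∀ (i j : Fin n) (h : j ≠ i), (i : ℕ) + 1 = j →
    ∀ v : GTSpace m, ⁅slUnit j i h, v⁆ = gtLower m j v
  diag : ∀ i j : Fin n, (i : ℕ) + 1 = j →
    ∀ v : GTSpace m, ⁅slDiag i j, v⁆ = gtDiag m i v - gtDiag m j v

/-- A highest weight vector of an `sl_n`-module: a nonzero common eigenvector of the diagonal
matrices that is annihilated by every `E_{i,j}` with `i < j`. -/
structure IsHighestWeightVector {n : ℕ} {M : Type*} [AddCommGroup M] [Module ℂ M]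
    [LieRingModule (SLn n) M] (v : M) : Prop where
  ne_zero : v ≠ 0
  weight : ∀ x : SLn n, (x : Matrix (Fin n) (Fin n) ℂ).IsDiag → ∃ c : ℂ, ⁅x, v⁆ = c • v
  upper : ∀ (i j : Fin n) (h : i ≠ j), i < j → ⁅slUnit i j h, v⁆ = 0

/-- The products (of any length, possibly empty) of the operators `E_{i,i+1}` on a module. -/
def raisingProducts (n : ℕ) (M : Type*) [AddCommGroup M] [Module ℂ M]
    [LieRingModule (SLn n) M] [LieModule ℂ (SLn n) M] : Submonoid (Module.End ℂ M) :=
  Submonoid.closure {T | ∃ (i j : Fin n) (h : i ≠ j), (i : ℕ) + 1 = j ∧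
    T = LieModule.toEnd ℂ (SLn n) M (slUnit i j h)}

/-- The products (of any length, possibly empty) of the operators `E_{i+1,i}` on a module. -/
def loweringProducts (n : ℕ) (M : Type*) [AddCommGroup M] [Module ℂ M]
    [LieRingModule (SLn n) M] [LieModule ℂ (SLn n) M] : Submonoid (Module.End ℂ M) :=
  Submonoid.closure {T | ∃ (i j : Fin n) (h : j ≠ i), (i : ℕ) + 1 = j ∧
    T = LieModule.toEnd ℂ (SLn n) M (slUnit j i h)}

/-- The pattern all of whose rows are initial segments of `m`. -/
noncomputable def gtHighestArray {n : ℕ} (m : Fin n → ℤ) : ℕ → ℕ → ℤ :=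
  fun k i => if h : k ≤ n ∧ i < k then m ⟨i, lt_of_lt_of_le h.2 h.1⟩ else 0

theorem isGTPattern_gtHighestArray {n : ℕ} {m : Fin n → ℤ} (hm : Antitone m) :
    IsGTPattern m (gtHighestArray m) where
  top_row i := by simp [gtHighestArray]
  le_upper k i hk hi := by
    have h1 : k ≤ n ∧ i < k := ⟨hk.le, hi⟩
    have h2 : k + 1 ≤ n ∧ i < k + 1 := ⟨hk, by omega⟩
    simp [gtHighestArray, h1, h2]
  lower_le k i hk hi := by
    have h1 : k ≤ n ∧ i < k := ⟨hk.le, hi⟩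
    have h2 : k + 1 ≤ n ∧ i + 1 < k + 1 := ⟨hk, by omega⟩
    simp only [gtHighestArray, h1, h2, and_self, dif_pos]
    exact hm (Fin.mk_le_mk.2 (Nat.le_succ i))
  zeros k i h := by
    have h1 : ¬ (k ≤ n ∧ i < k) := by omega
    simp only [gtHighestArray, h1, dif_neg, not_false_eq_true]

/-- The pattern all of whose rows are initial segments of the decreasing sequence `m`. -/
noncomputable def gtHighest {n : ℕ} (m : Fin n → ℤ) (hm : Antitone m) : GTPattern m :=
  ⟨gtHighestArray m, isGTPattern_gtHighestArray hm⟩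

/-!
The Gelfand–Tsetlin operators satisfy the relations `[E_i, F_j] = δ_{ij} (H_i - H_{i+1})` and
`[H_i, E_j]`, `[H_i, F_j]` of the Chevalley generators, and this suffices for an action of `sl_n`,
the Serre relations being automatic in finite dimension.

*The relations.*  All radicands are nonnegative, and a radicand vanishes when the corresponding
shifted array is not a pattern (`IsGTPattern.raiseSq_pos`, `IsGTPattern.raiseSq_eq_zero`,
`IsGTPattern.lowerSq_eq_zero`), so that arrays that are not patterns never contribute.  The lowering
coefficient is the raising coefficient of the shifted array (`raiseSq_gtShift_neg`), and raising one
entry commutes with lowering another one by an identity of products (`raiseSq_mul_lowerSq_comm`).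
What remains of `[E_k, F_k]` is a sum over row `k` of differences of radicands.  These radicands are,
up to sign, the residues of a rational function with poles at `l_{j,k}` and `l_{j,k} - 1` whose
numerator has the entries of the neighbouring rows as zeros; their sum is read off at infinity
(`sum_prod_div`, `IsGTPattern.sum_lowerSq_sub_raiseSq`).  Equal neighbouring entries produce double
poles, but interlacing makes the numerator vanish there to the same order.

*The Lie algebra.*  In a finite-dimensional Lie algebra, an element of `ad h`-weight `-d` killed by
`ad f` is killed by `(ad e)^(d+1)` (`ad_pow_eq_zero_of_lowest`).  Hence the brackets of iterated
brackets of the generators with the generators are those of the matrix units, and since the elements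
that a linear map transports correctly form a Lie subalgebra, testing on generators yields a
homomorphism (`IsChevalleyFamily.unitVectorMap_lie`).

*Raising to the highest pattern.*  Suppose that the first `K` rows of an array are initial segments
of its row `K`.  Raising row `K`, then row `K - 1`, and so on down to row `1`, each as often as
possible, turns these rows into initial segments of row `K + 1` (`gtRaise_pow_gtVec`, `gtStage`).
The exponents that occur for `K = 1, …, n - 1` determine the original pattern
(`IsGTPattern.eq_of_gtGap`), and a larger exponent gives zero.  Choosing among the patterns of the
support of a vector those with the largest exponent, stage after stage, leaves exactly one
(`exists_raising`).

*Generation and simplicity.*  With respect to the bilinear form with the patterns as orthonormal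
basis, `F_k` is the transpose of `E_k` (`gtForm_gtRaise`).  A vector orthogonal to everything
generated by the highest pattern could not be raised to a multiple of it, so it is zero
(`IsGTAction.span_lowering`).  A nonzero submodule contains the highest pattern by raising, and
therefore everything by lowering (`IsGTAction.isIrreducible`).
-/

/-! ### From Chevalley generators to the general linear Lie algebra -/

section UnitVector

variable {L : Type*} [LieRing L]

/-- The iterated bracket of `e i, …, e (i + d)`, in the role of the matrix unit
`E_{i,i+d+1}`. -/
def rootVector (e : ℕ → L) (i : ℕ) : ℕ → L
  | 0 => e i
  | d + 1 => ⁅rootVector e i d, e (i + d + 1)⁆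

/-- The element in the role of the matrix unit `E_{i,j}`.  Below the diagonal it is defined through
the Chevalley involution `E_{i,j} ↦ -E_{j,i}`. -/
def unitVector (e f H : ℕ → L) (i j : ℕ) : L :=
  if i < j then rootVector e i (j - i - 1)
  else if j < i then -rootVector (-f) j (i - j - 1)
  else H i

variable {e f H : ℕ → L}

theorem unitVector_swap (i j : ℕ) :
    unitVector (-f) (-e) (-H) i j = -unitVector e f H j i := by
  unfold unitVector
  by_cases h1 : i < j
  · rw [if_pos h1, if_neg (by omega), if_pos h1, neg_neg]
  · by_cases h2 : j < i
    · rw [if_neg h1, if_pos h2, if_pos h2, neg_neg]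
    · rw [if_neg h1, if_neg h2, if_neg h2, if_neg h1]
      obtain rfl : i = j := by omega
      rfl

theorem unitVector_add (i d : ℕ) : unitVector e f H i (i + d + 1) = rootVector e i d := by
  rw [unitVector, if_pos (by omega)]
  congr 1; omega

theorem unitVector_add' (i d : ℕ) : unitVector e f H (i + d + 1) i = -rootVector (-f) i d := by
  rw [unitVector, if_neg (by omega), if_pos (by omega)]
  congr 2; omega

theorem unitVector_self (i : ℕ) : unitVector e f H i i = H i := by
  simp [unitVector]

end UnitVector

section Chevalley

variable {L : Type*} [LieRing L] [LieAlgebra ℂ L]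

/-- In a finite-dimensional module, a lowest weight vector of weight `-d` is killed by the
`d + 1`-st power of the raising operator.  Unlike in `IsSl2Triple`, all three elements may
vanish. -/
theorem ad_pow_eq_zero_of_lowest [IsNoetherian ℂ L] {h e f x : L} (hef : ⁅e, f⁆ = h)
    (hhe : ⁅h, e⁆ = (2 : ℂ) • e) (hhf : ⁅h, f⁆ = (-2 : ℂ) • f) (d : ℕ) (hfx : ⁅f, x⁆ = 0)
    (hhx : ⁅h, x⁆ = (-d : ℂ) • x) : ((LieModule.toEnd ℂ L L e) ^ (d + 1)) x = 0 := by
  by_cases hx : x = 0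
  · simp [hx]
  by_cases hh : h = 0
  · have : e = 0 := by simpa [hh] using hhe.symm
    simp [this]
  have t : IsSl2Triple h e f := ⟨hh, hef, by rw [hhe, ofNat_smul_eq_nsmul],
    by rw [hhf, neg_smul, ofNat_smul_eq_nsmul]⟩
  have P : t.symm.HasPrimitiveVectorWith x (d : ℂ) := ⟨hx, by rw [neg_lie, hhx]; simp, hfx⟩
  exact P.pow_toEnd_f_eq_zero_of_eq_nat rfl

/-- The relations between the elements `e i` (in the role of the matrix unit `E_{i,i+1}`), `f i`
(in the role of `E_{i+1,i}`) and `H i` (in the role of `E_{i,i}`) of a Lie algebra that, together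
with the Serre relations, present `gl_n`.  Only indices in the range of `n × n` matrices matter. -/
structure IsChevalleyFamily (n : ℕ) (e f H : ℕ → L) : Prop where
  lie_e_f : ∀ i j, i + 1 < n → j + 1 < n →
    ⁅e i, f j⁆ = if i = j then H i - H (i + 1) else 0
  lie_H_e : ∀ i j, i < n → j + 1 < n →
    ⁅H i, e j⁆ = ((if i = j then 1 else 0) - (if i = j + 1 then 1 else 0) : ℂ) • e j
  lie_H_f : ∀ i j, i < n → j + 1 < n →
    ⁅H i, f j⁆ = ((if i = j + 1 then 1 else 0) - (if i = j then 1 else 0) : ℂ) • f j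
  lie_H_H : ∀ i j, i < n → j < n → ⁅H i, H j⁆ = 0

namespace IsChevalleyFamily

variable {n : ℕ} {e f H : ℕ → L}

/-- The Chevalley involution. -/
theorem swap (h : IsChevalleyFamily n e f H) : IsChevalleyFamily n (-f) (-e) (-H) where
  lie_e_f i j hi hj := by
    have := h.lie_e_f j i hj hi
    simp only [Pi.neg_apply, neg_lie, lie_neg, neg_neg]
    rw [← lie_skew, this]
    by_cases hij : i = j
    · subst hij; simp; abel
    · simp [hij, Ne.symm hij]
  lie_H_e i j hi hj := by
    rw [Pi.neg_apply, Pi.neg_apply, neg_lie, lie_neg, neg_neg, h.lie_H_f i j hi hj, smul_neg,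
      ← neg_smul, neg_sub]
  lie_H_f i j hi hj := by
    rw [Pi.neg_apply, Pi.neg_apply, neg_lie, lie_neg, neg_neg, h.lie_H_e i j hi hj, smul_neg,
      ← neg_smul, neg_sub]
  lie_H_H i j hi hj := by simp [h.lie_H_H i j hi hj]

theorem lie_H_rootVector (h : IsChevalleyFamily n e f H) (k i d : ℕ) (hk : k < n)
    (hi : i + d + 1 < n) :
    ⁅H k, rootVector e i d⁆ =
      ((if k = i then 1 else 0) - (if k = i + d + 1 then 1 else 0) : ℂ) • rootVector e i d := by
  induction d with
  | zero => simpa [rootVector] using h.lie_H_e k i hk (by omega)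
  | succ d ih =>
    rw [rootVector, leibniz_lie, ih (by omega), h.lie_H_e k _ hk (by omega), smul_lie, lie_smul,
      ← add_smul]
    congr 1
    have : i + (d + 1) + 1 = i + d + 1 + 1 := by omega
    rw [this]
    ring

theorem lie_f_e (h : IsChevalleyFamily n e f H) (i j : ℕ) (hi : i + 1 < n) (hj : j + 1 < n) :
    ⁅f i, e j⁆ = if i = j then -(H i - H (i + 1)) else 0 := by
  rw [← lie_skew, h.lie_e_f j i hj hi]
  by_cases hij : i = j
  · subst hij; simp
  · simp [hij, Ne.symm hij]

theorem ad_pow_eq_zero [IsNoetherian ℂ L] (h : IsChevalleyFamily n e f H) (k : ℕ)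
    (hk : k + 1 < n) (d : ℕ) {x : L} (hfx : ⁅f k, x⁆ = 0)
    (hhx : ⁅H k - H (k + 1), x⁆ = (-d : ℂ) • x) :
    ((LieModule.toEnd ℂ L L (e k)) ^ (d + 1)) x = 0 := by
  refine ad_pow_eq_zero_of_lowest (h := H k - H (k + 1)) (f := f k) ?_ ?_ ?_ d hfx hhx
  · simp [h.lie_e_f k k hk hk]
  · rw [sub_lie, h.lie_H_e k k (by omega) hk, h.lie_H_e (k + 1) k hk hk, ← sub_smul]
    congr 1; simp; norm_num
  · rw [sub_lie, h.lie_H_f k k (by omega) hk, h.lie_H_f (k + 1) k hk hk, ← sub_smul]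
    congr 1; simp; norm_num

theorem lie_e_eq_zero [IsNoetherian ℂ L] (h : IsChevalleyFamily n e f H) (k : ℕ)
    (hk : k + 1 < n) {x : L} (hfx : ⁅f k, x⁆ = 0) (hhx : ⁅H k - H (k + 1), x⁆ = 0) :
    ⁅e k, x⁆ = 0 := by
  simpa using h.ad_pow_eq_zero k hk 0 hfx (by simpa using hhx)

theorem lie_e_lie_e_eq_zero [IsNoetherian ℂ L] (h : IsChevalleyFamily n e f H) (k : ℕ)
    (hk : k + 1 < n) {x : L} (hfx : ⁅f k, x⁆ = 0) (hhx : ⁅H k - H (k + 1), x⁆ = -x) :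
    ⁅e k, ⁅e k, x⁆⁆ = 0 := by
  simpa [pow_succ] using h.ad_pow_eq_zero k hk 1 hfx (by simpa using hhx)

theorem lie_e_e_of_far [IsNoetherian ℂ L] (h : IsChevalleyFamily n e f H) (i j : ℕ)
    (hi : i + 1 < n) (hj : j + 1 < n) (hij : i + 1 < j ∨ j + 1 < i) : ⁅e i, e j⁆ = 0 := by
  refine h.lie_e_eq_zero i hi ?_ ?_
  · rw [h.lie_f_e i j hi hj, if_neg (by omega)]
  · rw [sub_lie, h.lie_H_e i j (by omega) hj, h.lie_H_e (i + 1) j hi hj, if_neg (by omega),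
      if_neg (by omega), if_neg (by omega), if_neg (by omega)]
    simp

theorem lie_rootVector_e_of_far [IsNoetherian ℂ L] (h : IsChevalleyFamily n e f H) (k i d : ℕ)
    (hk : k + 1 < n) (hd : i + d + 1 < k) : ⁅rootVector e i d, e k⁆ = 0 := by
  induction d with
  | zero => exact h.lie_e_e_of_far i k (by omega) hk (by omega)
  | succ d ih =>
    rw [rootVector, lie_lie, ih (by omega), h.lie_e_e_of_far _ k (by omega) hk (by omega)]
    simp

theorem lie_f_rootVector_zero (h : IsChevalleyFamily n e f H) (k i : ℕ)
    (hk : k + 1 < n) (hi : i + 1 < n) :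
    ⁅f k, rootVector e i 0⁆ = if k = i then -(H i - H (i + 1)) else 0 := by
  rw [rootVector, h.lie_f_e k i hk hi]
  split_ifs with hki
  · rw [hki]
  · rfl

theorem lie_rootVector_lie_f_e (h : IsChevalleyFamily n e f H) (k i d : ℕ) (hk : k + 1 < n)
    (hi : i + d + 1 + 1 < n) :
    ⁅rootVector e i d, ⁅f k, e (i + d + 1)⁆⁆ =
      -(if k = i + d + 1 then rootVector e i d else 0) := by
  rw [h.lie_f_e k _ hk hi]
  split_ifs with hki
  · subst hki
    rw [← lie_skew, neg_lie, neg_neg, sub_lie, h.lie_H_rootVector _ i d (by omega) (by omega),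
      h.lie_H_rootVector _ i d (by omega) (by omega)]
    rw [if_neg (by omega), if_pos rfl, if_neg (by omega), if_neg (by omega)]
    simp
  · simp

/-- The bracket of `f k` with a positive root vector that is not simple; its analogue for a simple
root vector is the relation `lie_f_e`, where the answer lies in the diagonal. -/
theorem lie_f_rootVector_succ [IsNoetherian ℂ L] (h : IsChevalleyFamily n e f H) (k i d : ℕ)
    (hk : k + 1 < n) (hi : i + (d + 1) + 1 < n) :
    ⁅f k, rootVector e i (d + 1)⁆ = (if k = i then rootVector e (i + 1) d else 0) -
      (if k = i + d + 1 then rootVector e i d else 0) := by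
  induction d with
  | zero =>
    rw [rootVector.eq_2, leibniz_lie, h.lie_rootVector_lie_f_e k i 0 hk hi, sub_eq_add_neg,
      h.lie_f_rootVector_zero k i hk (by omega)]
    congr 1
    split_ifs with hki
    · rw [neg_lie, sub_lie, h.lie_H_e i _ (by omega) (by omega),
        h.lie_H_e (i + 1) _ (by omega) (by omega), if_neg (by omega), if_neg (by omega),
        if_pos (by omega), if_neg (by omega)]
      simp [rootVector]
    · simp
  | succ d ih =>
    rw [rootVector, leibniz_lie, h.lie_rootVector_lie_f_e k i (d + 1) hk hi, ih (by omega),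
      sub_lie, sub_eq_add_neg (ite _ _ _)]
    have far : ⁅(if k = i + d + 1 then rootVector e i d else 0), e (i + (d + 1) + 1)⁆ = 0 := by
      split_ifs
      · exact h.lie_rootVector_e_of_far _ i d (by omega) (by omega)
      · simp
    rw [far, sub_zero]
    congr 1
    split_ifs
    · have : i + (d + 1) + 1 = i + 1 + d + 1 := by omega
      rw [this, rootVector]
    · simp

theorem lie_e_rootVector_succ_left [IsNoetherian ℂ L] (h : IsChevalleyFamily n e f H)
    (k d : ℕ) (hk : k + 1 + d + 1 < n) :
    ⁅e k, rootVector e (k + 1) d⁆ = rootVector e k (d + 1) := by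
  induction d with
  | zero => rfl
  | succ d ih =>
    rw [rootVector, leibniz_lie, ih (by omega),
      h.lie_e_e_of_far k _ (by omega) (by omega) (by omega), lie_zero, add_zero]
    have : k + 1 + d + 1 = k + (d + 1) + 1 := by omega
    rw [this, ← rootVector]

/-- The bracket of a simple root vector with any positive root vector.  Where it vanishes, this
is a Serre relation or one of its consequences; it holds because the element in question is the
image of a lowest weight vector under a sufficiently high power of `ad (e k)`. -/
theorem lie_e_rootVector [IsNoetherian ℂ L] (h : IsChevalleyFamily n e f H) (k i d : ℕ)
    (hk : k + 1 < n) (hi : i + d + 1 < n) :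
    ⁅e k, rootVector e i d⁆ = (if k + 1 = i then rootVector e k (d + 1) else 0) -
      (if k = i + d + 1 then rootVector e i (d + 1) else 0) := by
  by_cases h1 : k + 1 = i
  · subst h1
    rw [if_pos rfl, if_neg (by omega), sub_zero, h.lie_e_rootVector_succ_left k d hi]
  by_cases h2 : k = i + d + 1
  · subst h2
    rw [if_neg h1, if_pos rfl, zero_sub, ← lie_skew, rootVector]
  rw [if_neg h1, if_neg h2, sub_zero]
  by_cases h3 : k = i
  · subst h3
    rcases d with _ | d
    · exact lie_self _
    rw [← h.lie_e_rootVector_succ_left k d (by omega)]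
    refine h.lie_e_lie_e_eq_zero k hk ?_ ?_
    · rcases d with _ | d
      · rw [h.lie_f_rootVector_zero _ _ hk (by omega), if_neg (by omega)]
      · rw [h.lie_f_rootVector_succ _ _ _ hk (by omega), if_neg (by omega), if_neg (by omega),
          sub_zero]
    · rw [sub_lie, h.lie_H_rootVector _ _ _ (by omega) (by omega),
        h.lie_H_rootVector _ _ _ (by omega) (by omega), if_neg (by omega), if_neg (by omega),
        if_pos rfl, if_neg (by omega)]
      simp
  by_cases h4 : k = i + d
  · obtain ⟨d, rfl⟩ : ∃ d', d = d' + 1 := ⟨d - 1, by omega⟩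
    rw [h4, ← add_assoc, rootVector, ← lie_skew (rootVector e i d) (e _),
      lie_neg, neg_eq_zero]
    refine h.lie_e_lie_e_eq_zero _ (by omega) ?_ ?_
    · rcases d with _ | d
      · rw [h.lie_f_rootVector_zero _ _ (by omega) (by omega), if_neg (by omega)]
      · rw [h.lie_f_rootVector_succ _ _ _ (by omega) (by omega), if_neg (by omega),
          if_neg (by omega), sub_zero]
    · rw [sub_lie, h.lie_H_rootVector _ _ _ (by omega) (by omega),
        h.lie_H_rootVector _ _ _ (by omega) (by omega), if_neg (by omega), if_pos (by omega),
        if_neg (by omega), if_neg (by omega)]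
      simp
  · refine h.lie_e_eq_zero k hk ?_ ?_
    · rcases d with _ | d
      · rw [h.lie_f_rootVector_zero _ _ hk (by omega), if_neg (by omega)]
      · rw [h.lie_f_rootVector_succ _ _ _ hk (by omega), if_neg (by omega), if_neg (by omega),
          sub_zero]
    · rw [sub_lie, h.lie_H_rootVector _ _ _ (by omega) (by omega),
        h.lie_H_rootVector _ _ _ (by omega) (by omega), if_neg (by omega), if_neg (by omega),
        if_neg (by omega), if_neg (by omega)]
      simp

theorem lie_e_unitVector [IsNoetherian ℂ L] (h : IsChevalleyFamily n e f H) (k i j : ℕ)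
    (hk : k + 1 < n) (hi : i < n) (hj : j < n) :
    ⁅e k, unitVector e f H i j⁆ = (if k + 1 = i then unitVector e f H k j else 0) -
      (if j = k then unitVector e f H i (k + 1) else 0) := by
  rcases lt_trichotomy i j with hij | rfl | hij
  · obtain ⟨d, rfl⟩ : ∃ d, j = i + d + 1 := ⟨j - i - 1, by omega⟩
    rw [unitVector_add, h.lie_e_rootVector k i d hk hj]
    congr 1
    · split_ifs with h1
      · subst h1
        rw [show k + 1 + d + 1 = k + (d + 1) + 1 by omega, unitVector_add]
      · rfl
    · by_cases h1 : k = i + d + 1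
      · subst h1
        rw [if_pos rfl, if_pos rfl, show i + d + 1 + 1 = i + (d + 1) + 1 by omega, unitVector_add]
      · rw [if_neg h1, if_neg (Ne.symm h1)]
  · rw [unitVector_self, ← lie_skew, h.lie_H_e i k hi hk]
    by_cases h1 : i = k
    · subst h1
      have := unitVector_add (e := e) (f := f) (H := H) i 0
      simp only [add_zero] at this
      simp [this, rootVector]
    · by_cases h2 : k + 1 = i
      · subst h2
        have := unitVector_add (e := e) (f := f) (H := H) k 0
        simp only [add_zero] at this
        simp [this, rootVector]
      · rw [if_neg h1, if_neg (Ne.symm h2), if_neg h2, if_neg h1]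
        simp
  · obtain ⟨d, rfl⟩ : ∃ d, i = j + d + 1 := ⟨i - j - 1, by omega⟩
    have e1 : ⁅e k, unitVector e f H (j + d + 1) j⁆ = ⁅(-e) k, rootVector (-f) j d⁆ := by
      rw [unitVector_add', Pi.neg_apply, lie_neg, neg_lie]
    rw [e1]
    rcases d with _ | d
    · rw [h.swap.lie_f_rootVector_zero k j hk hi]
      by_cases h1 : k = j
      · subst h1
        simp only [add_zero, if_true, unitVector_self, Pi.neg_apply]
        abel
      · rw [if_neg h1, if_neg (by omega), if_neg (by omega), sub_zero]
    · rw [h.swap.lie_f_rootVector_succ k j d hk hi, sub_eq_add_neg, add_comm, sub_eq_add_neg]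
      congr 1
      · by_cases h1 : k = j + d + 1
        · rw [if_pos h1, if_pos (by omega), h1, unitVector_add']
        · rw [if_neg h1, if_neg (by omega), neg_zero]
      · by_cases h1 : k = j
        · subst h1
          rw [if_pos rfl, if_pos rfl, show k + (d + 1) + 1 = k + 1 + d + 1 by omega,
            unitVector_add', neg_neg]
        · rw [if_neg h1, if_neg (Ne.symm h1), neg_zero]

theorem lie_f_unitVector [IsNoetherian ℂ L] (h : IsChevalleyFamily n e f H) (k i j : ℕ)
    (hk : k + 1 < n) (hi : i < n) (hj : j < n) :
    ⁅f k, unitVector e f H i j⁆ = (if k = i then unitVector e f H (k + 1) j else 0) -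
      (if j = k + 1 then unitVector e f H i k else 0) := by
  have := h.swap.lie_e_unitVector k j i hk hj hi
  rw [unitVector_swap, unitVector_swap, unitVector_swap, Pi.neg_apply, lie_neg, neg_lie,
    neg_neg] at this
  rw [this]
  by_cases h1 : k = i <;> by_cases h2 : j = k + 1
  · subst h1; subst h2; simp; abel
  · subst h1; simp [h2, Ne.symm h2]
  · subst h2; simp [h1, Ne.symm h1]
  · simp [h1, Ne.symm h1, h2, Ne.symm h2]

theorem lie_H_unitVector (h : IsChevalleyFamily n e f H) (k i j : ℕ)
    (hk : k < n) (hi : i < n) (hj : j < n) :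
    ⁅H k, unitVector e f H i j⁆ = (if k = i then unitVector e f H k j else 0) -
      (if j = k then unitVector e f H i k else 0) := by
  rcases lt_trichotomy i j with hij | rfl | hij
  · obtain ⟨d, rfl⟩ : ∃ d, j = i + d + 1 := ⟨j - i - 1, by omega⟩
    rw [unitVector_add, h.lie_H_rootVector k i d hk hj, sub_smul]
    congr 1
    · split_ifs with h1
      · rw [h1, unitVector_add, one_smul]
      · simp
    · by_cases h1 : k = i + d + 1
      · rw [if_pos h1, if_pos h1.symm, h1, unitVector_add, one_smul]
      · rw [if_neg h1, if_neg (Ne.symm h1), zero_smul]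
  · rw [unitVector_self, h.lie_H_H k i hk hi]
    by_cases h1 : k = i
    · subst h1; simp
    · simp [h1, Ne.symm h1]
  · obtain ⟨d, rfl⟩ : ∃ d, i = j + d + 1 := ⟨i - j - 1, by omega⟩
    have e1 : ⁅H k, unitVector e f H (j + d + 1) j⁆ = ⁅(-H) k, rootVector (-f) j d⁆ := by
      rw [unitVector_add', Pi.neg_apply, lie_neg, neg_lie]
    rw [e1, h.swap.lie_H_rootVector k j d hk hi, sub_smul, sub_eq_add_neg, sub_eq_add_neg,
      add_comm]
    congr 1
    · by_cases h1 : k = j + d + 1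
      · rw [if_pos h1, if_pos h1, h1, unitVector_add', one_smul]
      · rw [if_neg h1, if_neg h1, zero_smul, neg_zero]
    · by_cases h1 : k = j
      · rw [if_pos h1, if_pos h1.symm, h1, unitVector_add', one_smul, neg_neg]
      · rw [if_neg h1, if_neg (Ne.symm h1), zero_smul, neg_zero]

end IsChevalleyFamily

attribute [local instance 100] LieRing.ofAssociativeRing

theorem lie_single_single {n : ℕ} (i j k l : Fin n) :
    ⁅Matrix.single i j (1 : ℂ), Matrix.single k l (1 : ℂ)⁆ =
      (if j = k then Matrix.single i l 1 else 0) - (if l = i then Matrix.single k j 1 else 0) := by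
  rw [LieRing.of_associative_ring_bracket]
  congr 1
  · split_ifs with h
    · subst h; simp
    · exact Matrix.single_mul_single_of_ne (h := h) ..
  · split_ifs with h
    · subst h; simp
    · exact Matrix.single_mul_single_of_ne (h := h) ..

/-- The matrix units generate the Lie algebra of matrices; those next to the diagonal and on it
suffice. -/
theorem single_mem_of_simple {n : ℕ} (S : LieSubalgebra ℂ (Matrix (Fin n) (Fin n) ℂ))
    (hdiag : ∀ i, Matrix.single i i 1 ∈ S)
    (hup : ∀ i j : Fin n, (i : ℕ) + 1 = j → Matrix.single i j 1 ∈ S)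
    (hdown : ∀ i j : Fin n, (i : ℕ) + 1 = j → Matrix.single j i 1 ∈ S) (i j : Fin n) :
    Matrix.single i j (1 : ℂ) ∈ S := by
  have main : ∀ (d : ℕ) (i j : Fin n), (i : ℕ) + d + 1 = j →
      Matrix.single i j (1 : ℂ) ∈ S ∧ Matrix.single j i (1 : ℂ) ∈ S := by
    intro d
    induction d with
    | zero => exact fun i j h => ⟨hup i j h, hdown i j h⟩
    | succ d ih =>
      intro i j h
      have hj := j.2
      let l : Fin n := ⟨i + d + 1, by omega⟩
      have hij : i ≠ j := by rintro rfl; omega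
      obtain ⟨h1, h2⟩ := ih i l rfl
      have hl : (l : ℕ) + 1 = j := by simp only [l]; omega
      constructor
      · have := S.lie_mem h1 (hup l j hl)
        simpa [lie_single_single, hij.symm] using this
      · have := S.lie_mem (hdown l j hl) h2
        simpa [lie_single_single, hij] using this
  rcases lt_trichotomy i j with h | rfl | h
  · exact (main (j - i - 1) i j (by have : (i : ℕ) < j := h; omega)).1
  · exact hdiag i
  · exact (main (i - j - 1) j i (by have : (j : ℕ) < i := h; omega)).2

/-- The linear extension of `E_{i,j} ↦ unitVector e f H i j`. -/
noncomputable def unitVectorMap (n : ℕ) (e f H : ℕ → L) : Matrix (Fin n) (Fin n) ℂ →ₗ[ℂ] L where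
  toFun A := ∑ i, ∑ j, A i j • unitVector e f H i j
  map_add' A B := by simp [add_smul, Finset.sum_add_distrib]
  map_smul' c A := by simp [Finset.smul_sum, mul_smul]

theorem unitVectorMap_single {n : ℕ} {e f H : ℕ → L} (i j : Fin n) :
    unitVectorMap n e f H (Matrix.single i j 1) = unitVector e f H i j := by
  simp only [unitVectorMap, LinearMap.coe_mk, AddHom.coe_mk]
  rw [Finset.sum_eq_single i, Finset.sum_eq_single j]
  · simp
  · intro b _ hb; simp [Matrix.single, hb.symm]
  · simp
  · intro b _ hb; simp [Matrix.single, hb.symm]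
  · simp

/-- The elements `x` for which a linear map commutes with bracketing by `x` form a Lie
subalgebra. -/
def bracketCompatible {L' : Type*} [LieRing L'] [LieAlgebra ℂ L'] (φ : L' →ₗ[ℂ] L) :
    LieSubalgebra ℂ L' where
  carrier := {x | ∀ y, φ ⁅x, y⁆ = ⁅φ x, φ y⁆}
  add_mem' hx hy z := by simp [hx z, hy z]
  zero_mem' z := by simp
  smul_mem' c x hx z := by simp [hx z]
  lie_mem' {x y} hx hy z := by
    rw [lie_lie, map_sub, hx, hy, hy, hx, hx y, lie_lie]

/-- A Chevalley family in a finite-dimensional Lie algebra extends to a homomorphism from the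
Lie algebra of all matrices. -/
theorem IsChevalleyFamily.unitVectorMap_lie [IsNoetherian ℂ L] {n : ℕ} {e f H : ℕ → L}
    (h : IsChevalleyFamily n e f H) (A B : Matrix (Fin n) (Fin n) ℂ) :
    unitVectorMap n e f H ⁅A, B⁆ = ⁅unitVectorMap n e f H A, unitVectorMap n e f H B⁆ := by
  set φ := unitVectorMap n e f H with hφ
  -- By bilinearity it suffices to test an element on matrix units.
  have test : ∀ A, (∀ i j, φ ⁅A, Matrix.single i j 1⁆ = ⁅φ A, φ (Matrix.single i j 1)⁆) →
      A ∈ bracketCompatible φ := by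
    intro A hA B
    rw [Matrix.matrix_eq_sum_single B]
    have : ∀ i j, Matrix.single i j (B i j) = B i j • Matrix.single i j (1 : ℂ) := by
      intro i j; simp
    simp only [this, lie_sum, map_sum, lie_smul, map_smul, hA]
  have gen : ∀ i j, Matrix.single i j (1 : ℂ) ∈ bracketCompatible φ := by
    refine single_mem_of_simple _ ?_ ?_ ?_
    · intro k
      refine test _ fun i j => ?_
      rw [lie_single_single, map_sub, apply_ite φ, apply_ite φ, hφ]
      simp only [unitVectorMap_single, map_zero, unitVector_self]
      rw [h.lie_H_unitVector k i j k.2 i.2 j.2]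
      simp only [Fin.ext_iff]
    · intro k l hkl
      refine test _ fun i j => ?_
      rw [lie_single_single, map_sub, apply_ite φ, apply_ite φ, hφ]
      simp only [unitVectorMap_single, map_zero]
      have := unitVector_add (e := e) (f := f) (H := H) k 0
      rw [← hkl, this, rootVector, h.lie_e_unitVector k i j (by omega) i.2 j.2]
      simp only [Fin.ext_iff, ← hkl]
    · intro k l hkl
      refine test _ fun i j => ?_
      rw [lie_single_single, map_sub, apply_ite φ, apply_ite φ, hφ]
      simp only [unitVectorMap_single, map_zero]
      have := unitVector_add' (e := e) (f := f) (H := H) k 0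
      rw [← hkl, this, rootVector, Pi.neg_apply, neg_neg,
        h.lie_f_unitVector k i j (by omega) i.2 j.2]
      simp only [Fin.ext_iff, ← hkl]
  have : A ∈ bracketCompatible φ := by
    rw [Matrix.matrix_eq_sum_single A]
    refine sum_mem fun i _ => sum_mem fun j _ => ?_
    have : Matrix.single i j (A i j) = A i j • Matrix.single i j (1 : ℂ) := by simp
    rw [this]
    exact (bracketCompatible φ).smul_mem _ (gen i j)
  exact this B

end Chevalley

/-! ### A residue identity -/

section Residue

open Polynomial in
/-- Lagrange interpolation of the difference of two monic polynomials of the same degree. -/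
theorem sum_prod_div_of_injOn {ι : Type*} [DecidableEq ι] (s : Finset ι) (z w : ι → ℝ)
    (hz : Set.InjOn z s) :
    ∑ a ∈ s, (w a - z a) * ∏ b ∈ s.erase a, ((w b - z a) / (z b - z a)) =
      ∑ a ∈ s, (w a - z a) := by
  rcases s.eq_empty_or_nonempty with rfl | hs
  · simp
  have hcard := hs.card_pos
  set P : ℝ[X] := ∏ i ∈ s, (X - C (w i)) - ∏ i ∈ s, (X - C (z i)) with hP
  have hdeg : P.degree < s.card := by
    refine lt_of_lt_of_eq (degree_sub_lt_left ?_ ?_ ?_) (Lagrange.degree_nodal (s := s) (v := w))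
    · exact (Lagrange.degree_nodal (s := s) (v := w)).trans
        (Lagrange.degree_nodal (s := s) (v := z)).symm
    · exact Lagrange.nodal_ne_zero (s := s) (v := w)
    · exact (Lagrange.nodal_monic (s := s) (v := w)).leadingCoeff.trans
        (Lagrange.nodal_monic (s := s) (v := z)).leadingCoeff.symm
  have h := Lagrange.coeff_eq_sum hz hdeg
  rw [hP, coeff_sub, prod_X_sub_C_coeff_card_pred _ _ hcard,
    prod_X_sub_C_coeff_card_pred _ _ hcard] at h
  have h' : ∀ a ∈ s, (w a - z a) * ∏ b ∈ s.erase a, ((w b - z a) / (z b - z a)) =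
      -(eval (z a) P / ∏ b ∈ s.erase a, (z a - z b)) := by
    intro a ha
    have e0 : ∏ i ∈ s, (z a - z i) = 0 := Finset.prod_eq_zero ha (sub_self _)
    have e1 : eval (z a) P = (z a - w a) * ∏ b ∈ s.erase a, (z a - w b) := by
      rw [hP, eval_sub, eval_prod, eval_prod, Finset.mul_prod_erase s (fun b => z a - w b) ha]
      simp [e0]
    rw [e1, mul_div_assoc, ← Finset.prod_div_distrib, ← neg_mul, neg_sub]
    congr 1
    refine Finset.prod_congr rfl fun b _ => ?_
    rw [← neg_sub (z a) (w b), ← neg_sub (z a) (z b), neg_div_neg_eq]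
  rw [← hP] at h
  rw [Finset.sum_congr rfl h', Finset.sum_neg_distrib, ← h, Finset.sum_sub_distrib]
  ring

/-- The sum of the residues of `∏ (t - w a) / ∏ (t - z a)`.  Nodes may coincide as long as the
poles that they cause are cancelled; the factors `0⁻¹ = 0` only occur in terms with a
vanishing factor. -/
theorem sum_prod_div {ι : Type*} [DecidableEq ι] (s : Finset ι) (z w : ι → ℝ)
    (hzw : ∀ a ∈ s, ∀ b ∈ s, a ≠ b → z a = z b → w a = z a) :
    ∑ a ∈ s, (w a - z a) * ∏ b ∈ s.erase a, ((w b - z a) / (z b - z a)) =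
      ∑ a ∈ s, (w a - z a) := by
  set s' := s.filter fun a => w a ≠ z a with hs'
  have hsub : s' ⊆ s := Finset.filter_subset _ _
  have hout : ∀ a ∈ s, a ∉ s' → w a - z a = 0 := by
    intro a ha h
    rw [sub_eq_zero]
    by_contra hne
    exact h (Finset.mem_filter.2 ⟨ha, hne⟩)
  have hinj : Set.InjOn z s' := by
    intro a ha b hb hab
    by_contra hne
    have ha' := Finset.mem_filter.1 (Finset.mem_coe.1 ha)
    exact ha'.2 (hzw a ha'.1 b (hsub hb) hne hab)
  have key := sum_prod_div_of_injOn s' z w hinj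
  rw [← Finset.sum_subset hsub (fun a ha h => hout a ha h), ← key]
  rw [← Finset.sum_subset hsub (fun a ha h => by rw [hout a ha h, zero_mul])]
  refine Finset.sum_congr rfl fun a ha => ?_
  congr 1
  symm
  refine Finset.prod_subset (Finset.erase_subset_erase _ hsub) fun b hb hb' => ?_
  have hba := Finset.ne_of_mem_erase hb
  have hbs := Finset.mem_of_mem_erase hb
  have hbs' : b ∉ s' := fun h => hb' (Finset.mem_erase.2 ⟨hba, h⟩)
  have hw : w b = z b := sub_eq_zero.1 (hout b hbs hbs')
  rw [hw]
  refine div_self (sub_ne_zero.2 fun h => ?_)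
  exact (Finset.mem_filter.1 ha).2 (hzw a (hsub ha) b hbs hba.symm h.symm)

end Residue

/-! ### The Gelfand–Tsetlin coefficients -/

section Coefficients

/-- The radicand of `gtRaiseCoeff`. -/
noncomputable def raiseSq (p : ℕ → ℕ → ℤ) (k j : ℕ) : ℝ :=
  -((∏ i ∈ Finset.range (k + 1), (gtL p (k + 1) i - gtL p k j)) *
      (∏ i ∈ Finset.range (k - 1), (gtL p (k - 1) i - gtL p k j - 1))) /
    ∏ i ∈ (Finset.range k).erase j, ((gtL p k i - gtL p k j) * (gtL p k i - gtL p k j - 1))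

/-- The radicand of `gtLowerCoeff`. -/
noncomputable def lowerSq (p : ℕ → ℕ → ℤ) (k j : ℕ) : ℝ :=
  -((∏ i ∈ Finset.range (k + 1), (gtL p (k + 1) i - gtL p k j + 1)) *
      (∏ i ∈ Finset.range (k - 1), (gtL p (k - 1) i - gtL p k j))) /
    ∏ i ∈ (Finset.range k).erase j, ((gtL p k i - gtL p k j + 1) * (gtL p k i - gtL p k j))

theorem gtShift_same (p : ℕ → ℕ → ℤ) (k j : ℕ) (d : ℤ) : gtShift p k j d k j = p k j + d := by
  simp [gtShift]

theorem gtShift_of_ne (p : ℕ → ℕ → ℤ) {k j k' j' : ℕ} (d : ℤ) (h : k' ≠ k ∨ j' ≠ j) :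
    gtShift p k j d k' j' = p k' j' := by
  rw [gtShift, if_neg (by tauto)]

theorem gtShift_gtShift_neg (p : ℕ → ℕ → ℤ) (k j : ℕ) (d d' : ℤ) (h : d + d' = 0) :
    gtShift (gtShift p k j d) k j d' = p := by
  funext k' j'
  unfold gtShift
  split_ifs
  · rw [add_assoc, h, add_zero]
  · rfl

theorem gtShift_comm (p : ℕ → ℕ → ℤ) (k j l i : ℕ) (d d' : ℤ) :
    gtShift (gtShift p k j d) l i d' = gtShift (gtShift p l i d') k j d := by
  funext k' j'
  unfold gtShift
  split_ifs <;> ring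

theorem gtL_gtShift_same (p : ℕ → ℕ → ℤ) (k j : ℕ) (d : ℤ) :
    gtL (gtShift p k j d) k j = gtL p k j + d := by
  simp [gtL, gtShift_same]; ring

theorem gtL_gtShift_of_ne (p : ℕ → ℕ → ℤ) {k j k' j' : ℕ} (d : ℤ) (h : k' ≠ k ∨ j' ≠ j) :
    gtL (gtShift p k j d) k' j' = gtL p k' j' := by
  simp [gtL, gtShift_of_ne p d h]

theorem raiseSq_gtShift_neg (p : ℕ → ℕ → ℤ) {k : ℕ} (hk : 1 ≤ k) (j : ℕ) :
    raiseSq (gtShift p k j (-1)) k j = lowerSq p k j := by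
  unfold raiseSq lowerSq
  congr 1
  · congr 2
    · refine Finset.prod_congr rfl fun i _ => ?_
      rw [gtL_gtShift_same, gtL_gtShift_of_ne _ _ (by omega)]
      push_cast; ring
    · refine Finset.prod_congr rfl fun i _ => ?_
      rw [gtL_gtShift_same, gtL_gtShift_of_ne _ _ (by omega)]
      push_cast; ring
  · refine Finset.prod_congr rfl fun i hi => ?_
    have := Finset.ne_of_mem_erase hi
    rw [gtL_gtShift_same, gtL_gtShift_of_ne _ _ (by omega)]
    push_cast; ring

theorem lowerSq_gtShift_one (p : ℕ → ℕ → ℤ) {k : ℕ} (hk : 1 ≤ k) (j : ℕ) :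
    lowerSq (gtShift p k j 1) k j = raiseSq p k j := by
  rw [← raiseSq_gtShift_neg _ hk, gtShift_gtShift_neg _ _ _ _ _ (by norm_num)]

/-- Raising one entry and lowering another: the products of squared coefficients along the two
paths agree.  The coefficients interact through a single factor each; for entries of the same row
it sits in the denominators, for entries of neighbouring rows in the numerators. -/
theorem raiseSq_mul_lowerSq_comm (p : ℕ → ℕ → ℤ) {k l i j : ℕ} (hk : 1 ≤ k) (hl : 1 ≤ l)
    (hj : j < k) (hi : i < l) (h : k ≠ l ∨ j ≠ i) :
    lowerSq p l i * raiseSq (gtShift p l i (-1)) k j =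
      raiseSq p k j * lowerSq (gtShift p k j 1) l i := by
  have hkj : gtL (gtShift p l i (-1)) k j = gtL p k j := gtL_gtShift_of_ne _ _ (by omega)
  have hli : gtL (gtShift p k j 1) l i = gtL p l i := gtL_gtShift_of_ne _ _ (by omega)
  by_cases hkl : k = l
  · subst hkl
    have hji : j ≠ i := by tauto
    have hij : i ∈ (Finset.range k).erase j := Finset.mem_erase.2 ⟨hji.symm, by simpa using hi⟩
    have hji' : j ∈ (Finset.range k).erase i := Finset.mem_erase.2 ⟨hji, by simpa using hj⟩
    unfold raiseSq lowerSq
    simp only [hkj, hli]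
    rw [← Finset.mul_prod_erase _ _ hij, ← Finset.mul_prod_erase _ _ hji',
      ← Finset.mul_prod_erase _ _ hij, ← Finset.mul_prod_erase _ _ hji']
    rw [gtL_gtShift_same, gtL_gtShift_same]
    have up : ∀ s, gtL (gtShift p k i (-1)) (k + 1) s = gtL p (k + 1) s :=
      fun s => gtL_gtShift_of_ne _ _ (by omega)
    have up' : ∀ s, gtL (gtShift p k j 1) (k + 1) s = gtL p (k + 1) s :=
      fun s => gtL_gtShift_of_ne _ _ (by omega)
    have dn : ∀ s, gtL (gtShift p k i (-1)) (k - 1) s = gtL p (k - 1) s :=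
      fun s => gtL_gtShift_of_ne _ _ (by omega)
    have dn' : ∀ s, gtL (gtShift p k j 1) (k - 1) s = gtL p (k - 1) s :=
      fun s => gtL_gtShift_of_ne _ _ (by omega)
    have m1 : ∏ s ∈ ((Finset.range k).erase j).erase i,
        ((gtL (gtShift p k i (-1)) k s - gtL p k j) *
          (gtL (gtShift p k i (-1)) k s - gtL p k j - 1)) =
        ∏ s ∈ ((Finset.range k).erase j).erase i,
          ((gtL p k s - gtL p k j) * (gtL p k s - gtL p k j - 1)) :=
      Finset.prod_congr rfl fun s hs => by
        rw [gtL_gtShift_of_ne _ _ (Or.inr (Finset.ne_of_mem_erase hs))]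
    have m2 : ∏ s ∈ ((Finset.range k).erase i).erase j,
        ((gtL (gtShift p k j 1) k s - gtL p k i + 1) *
          (gtL (gtShift p k j 1) k s - gtL p k i)) =
        ∏ s ∈ ((Finset.range k).erase i).erase j,
          ((gtL p k s - gtL p k i + 1) * (gtL p k s - gtL p k i)) :=
      Finset.prod_congr rfl fun s hs => by
        rw [gtL_gtShift_of_ne _ _ (Or.inr (Finset.ne_of_mem_erase hs))]
    simp only [up, up', dn, dn', m1, m2]
    rw [div_mul_div_comm, div_mul_div_comm]
    push_cast
    congr 1 <;> ring
  by_cases h1 : l = k + 1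
  · subst h1
    have hir : i ∈ Finset.range (k + 1) := by simpa using hi
    have hjr : j ∈ Finset.range k := by simpa using hj
    unfold raiseSq lowerSq
    simp only [hkj, hli, Nat.add_sub_cancel]
    rw [← Finset.mul_prod_erase _ (fun s => gtL p k s - gtL p (k + 1) i) hjr,
      ← Finset.mul_prod_erase _ (fun s => gtL p (k + 1) s - gtL p k j) hir,
      ← Finset.mul_prod_erase _ (fun s => gtL (gtShift p k j 1) k s - gtL p (k + 1) i) hjr,
      ← Finset.mul_prod_erase _ (fun s => gtL (gtShift p (k + 1) i (-1)) (k + 1) s - gtL p k j) hir,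
      gtL_gtShift_same, gtL_gtShift_same]
    have m1 : ∏ s ∈ (Finset.range (k + 1)).erase i,
        (gtL (gtShift p (k + 1) i (-1)) (k + 1) s - gtL p k j) =
        ∏ s ∈ (Finset.range (k + 1)).erase i, (gtL p (k + 1) s - gtL p k j) :=
      Finset.prod_congr rfl fun s hs => by
        rw [gtL_gtShift_of_ne _ _ (Or.inr (Finset.ne_of_mem_erase hs))]
    have m2 : ∏ s ∈ (Finset.range k).erase j, (gtL (gtShift p k j 1) k s - gtL p (k + 1) i) =
        ∏ s ∈ (Finset.range k).erase j, (gtL p k s - gtL p (k + 1) i) :=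
      Finset.prod_congr rfl fun s hs => by
        rw [gtL_gtShift_of_ne _ _ (Or.inr (Finset.ne_of_mem_erase hs))]
    have a1 : ∀ s, gtL (gtShift p (k + 1) i (-1)) k s = gtL p k s :=
      fun s => gtL_gtShift_of_ne _ _ (by omega)
    have a2 : ∀ s, gtL (gtShift p (k + 1) i (-1)) (k - 1) s = gtL p (k - 1) s :=
      fun s => gtL_gtShift_of_ne _ _ (by omega)
    have a3 : ∀ s, gtL (gtShift p k j 1) (k + 1) s = gtL p (k + 1) s :=
      fun s => gtL_gtShift_of_ne _ _ (by omega)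
    have a4 : ∀ s, gtL (gtShift p k j 1) (k + 1 + 1) s = gtL p (k + 1 + 1) s :=
      fun s => gtL_gtShift_of_ne _ _ (by omega)
    simp only [m1, m2, a1, a2, a3, a4]
    rw [div_mul_div_comm, div_mul_div_comm]
    push_cast
    congr 1 <;> ring
  by_cases h2 : k = l + 1
  · subst h2
    have hir : i ∈ Finset.range l := by simpa using hi
    have hjr : j ∈ Finset.range (l + 1) := by simpa using hj
    unfold raiseSq lowerSq
    simp only [hkj, hli, Nat.add_sub_cancel]
    rw [← Finset.mul_prod_erase _ (fun s => gtL p l s - gtL p (l + 1) j - 1) hir,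
      ← Finset.mul_prod_erase _ (fun s => gtL p (l + 1) s - gtL p l i + 1) hjr,
      ← Finset.mul_prod_erase _
        (fun s => gtL (gtShift p l i (-1)) l s - gtL p (l + 1) j - 1) hir,
      ← Finset.mul_prod_erase _
        (fun s => gtL (gtShift p (l + 1) j 1) (l + 1) s - gtL p l i + 1) hjr,
      gtL_gtShift_same, gtL_gtShift_same]
    have m1 : ∏ s ∈ (Finset.range (l + 1)).erase j,
        (gtL (gtShift p (l + 1) j 1) (l + 1) s - gtL p l i + 1) =
        ∏ s ∈ (Finset.range (l + 1)).erase j, (gtL p (l + 1) s - gtL p l i + 1) :=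
      Finset.prod_congr rfl fun s hs => by
        rw [gtL_gtShift_of_ne _ _ (Or.inr (Finset.ne_of_mem_erase hs))]
    have m2 : ∏ s ∈ (Finset.range l).erase i,
          (gtL (gtShift p l i (-1)) l s - gtL p (l + 1) j - 1) =
        ∏ s ∈ (Finset.range l).erase i, (gtL p l s - gtL p (l + 1) j - 1) :=
      Finset.prod_congr rfl fun s hs => by
        rw [gtL_gtShift_of_ne _ _ (Or.inr (Finset.ne_of_mem_erase hs))]
    have a1 : ∀ s, gtL (gtShift p (l + 1) j 1) l s = gtL p l s :=
      fun s => gtL_gtShift_of_ne _ _ (by omega)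
    have a2 : ∀ s, gtL (gtShift p (l + 1) j 1) (l - 1) s = gtL p (l - 1) s :=
      fun s => gtL_gtShift_of_ne _ _ (by omega)
    have a3 : ∀ s, gtL (gtShift p l i (-1)) (l + 1) s = gtL p (l + 1) s :=
      fun s => gtL_gtShift_of_ne _ _ (by omega)
    have a4 : ∀ s, gtL (gtShift p l i (-1)) (l + 1 + 1) s = gtL p (l + 1 + 1) s :=
      fun s => gtL_gtShift_of_ne _ _ (by omega)
    simp only [m1, m2, a1, a2, a3, a4]
    rw [div_mul_div_comm, div_mul_div_comm]
    push_cast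
    congr 1 <;> ring
  · have a1 : ∀ s, gtL (gtShift p l i (-1)) (k + 1) s = gtL p (k + 1) s :=
      fun s => gtL_gtShift_of_ne _ _ (by omega)
    have a2 : ∀ s, gtL (gtShift p l i (-1)) k s = gtL p k s :=
      fun s => gtL_gtShift_of_ne _ _ (by omega)
    have a3 : ∀ s, gtL (gtShift p l i (-1)) (k - 1) s = gtL p (k - 1) s :=
      fun s => gtL_gtShift_of_ne _ _ (by omega)
    have b1 : ∀ s, gtL (gtShift p k j 1) (l + 1) s = gtL p (l + 1) s :=
      fun s => gtL_gtShift_of_ne _ _ (by omega)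
    have b2 : ∀ s, gtL (gtShift p k j 1) l s = gtL p l s :=
      fun s => gtL_gtShift_of_ne _ _ (by omega)
    have b3 : ∀ s, gtL (gtShift p k j 1) (l - 1) s = gtL p (l - 1) s :=
      fun s => gtL_gtShift_of_ne _ _ (by omega)
    unfold raiseSq lowerSq
    simp only [a1, a2, a3, b1, b2, b3]
    ring
end Coefficients

/-! ### Interlacing and the signs of the coefficients -/

section Patterns

namespace IsGTPattern

variable {n : ℕ} {m : Fin n → ℤ} {p : ℕ → ℕ → ℤ}

theorem row_succ_le (h : IsGTPattern m p) {k i : ℕ} (hk : k < n) (hi : i + 1 < k) :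
    p k (i + 1) ≤ p k i :=
  (h.le_upper k (i + 1) hk hi).trans (h.lower_le k i hk (by omega))

theorem row_antitone (h : IsGTPattern m p) {k i j : ℕ} (hk : k < n) (hij : i ≤ j) (hj : j < k) :
    p k j ≤ p k i := by
  induction j, hij using Nat.le_induction with
  | base => exact le_rfl
  | succ j hij ih => exact (h.row_succ_le hk hj).trans (ih (by omega))

theorem gtShift_one_iff (h : IsGTPattern m p) {k j : ℕ} (hk : k < n) (hj : j < k) :
    IsGTPattern m (gtShift p k j 1) ↔
      p k j < p (k + 1) j ∧ (1 ≤ j → p k j < p (k - 1) (j - 1)) := by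
  constructor
  · intro h'
    refine ⟨?_, fun hj1 => ?_⟩
    · have := h'.le_upper k j hk hj
      rw [gtShift_same, gtShift_of_ne _ _ (by omega)] at this
      omega
    · have := h'.lower_le (k - 1) (j - 1) (by omega) (by omega)
      rw [Nat.sub_add_cancel (by omega), Nat.sub_add_cancel hj1, gtShift_same,
        gtShift_of_ne _ _ (by omega)] at this
      omega
  · rintro ⟨h1, h2⟩
    refine ⟨fun i => ?_, fun k' i hk' hi => ?_, fun k' i hk' hi => ?_, fun k' i hki => ?_⟩
    · rw [gtShift_of_ne _ _ (by omega)]; exact h.top_row i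
    · have := h.le_upper k' i hk' hi
      unfold gtShift
      split_ifs with c1 c2 c2
      · omega
      · obtain ⟨rfl, rfl⟩ := c1; omega
      · omega
      · omega
    · have := h.lower_le k' i hk' hi
      unfold gtShift
      split_ifs with c1 c2 c2
      · omega
      · obtain ⟨rfl, rfl⟩ := c1
        have := h2 (by omega)
        simp only [Nat.add_sub_cancel] at this
        omega
      · omega
      · omega
    · rw [gtShift_of_ne _ _ (by omega)]; exact h.zeros k' i hki

theorem gtShift_neg_one_iff (h : IsGTPattern m p) {k j : ℕ} (hk : k < n) (hj : j < k) :
    IsGTPattern m (gtShift p k j (-1)) ↔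
      p (k + 1) (j + 1) < p k j ∧ (j + 1 < k → p (k - 1) j < p k j) := by
  constructor
  · intro h'
    refine ⟨?_, fun hj1 => ?_⟩
    · have := h'.lower_le k j hk hj
      rw [gtShift_same, gtShift_of_ne _ _ (by omega)] at this
      omega
    · have := h'.le_upper (k - 1) j (by omega) (by omega)
      rw [Nat.sub_add_cancel (by omega), gtShift_same, gtShift_of_ne _ _ (by omega)] at this
      omega
  · rintro ⟨h1, h2⟩
    refine ⟨fun i => ?_, fun k' i hk' hi => ?_, fun k' i hk' hi => ?_, fun k' i hki => ?_⟩
    · rw [gtShift_of_ne _ _ (by omega)]; exact h.top_row i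
    · have := h.le_upper k' i hk' hi
      unfold gtShift
      split_ifs with c1 c2 c2
      · omega
      · omega
      · obtain ⟨rfl, rfl⟩ := c2
        have := h2 (by omega)
        simp only [Nat.add_sub_cancel] at this
        omega
      · omega
    · have := h.lower_le k' i hk' hi
      unfold gtShift
      split_ifs with c1 c2 c2
      · omega
      · omega
      · obtain ⟨rfl, rfl⟩ := c2; omega
      · omega
    · rw [gtShift_of_ne _ _ (by omega)]; exact h.zeros k' i hki

end IsGTPattern

/-- The poles of the rational function whose residues are the radicands of the coefficients
of row `k`, up to sign: at `l_{j,k}` for raising and at `l_{j,k} - 1` for lowering. -/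
noncomputable def gtPole (p : ℕ → ℕ → ℤ) (k : ℕ) : ℕ ⊕ ℕ → ℝ :=
  Sum.elim (gtL p k) fun i => gtL p k i - 1

/-- The zeros of the rational function with poles `gtPole p (r + 1)`.  They are indexed in such a
way that a multiple pole is cancelled by the zeros with the same indices. -/
noncomputable def gtZero (p : ℕ → ℕ → ℤ) (r : ℕ) : ℕ ⊕ ℕ → ℝ :=
  Sum.elim (gtL p (r + 1 + 1)) fun i => if i < r then gtL p r i - 1 else gtL p (r + 1 + 1) (r + 1)

theorem prod_gtZero (p : ℕ → ℕ → ℤ) (r : ℕ) (t : ℝ) :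
    (∏ i ∈ Finset.range (r + 1), (gtZero p r (.inl i) - t)) *
        ∏ i ∈ Finset.range (r + 1), (gtZero p r (.inr i) - t) =
      (∏ i ∈ Finset.range (r + 1 + 1), (gtL p (r + 1 + 1) i - t)) *
        ∏ i ∈ Finset.range r, (gtL p r i - 1 - t) := by
  rw [Finset.prod_range_succ _ (r + 1), Finset.prod_range_succ (fun i => gtZero p r (.inr i) - t) r]
  have : ∏ i ∈ Finset.range r, (gtZero p r (.inr i) - t) =
      ∏ i ∈ Finset.range r, (gtL p r i - 1 - t) :=
    Finset.prod_congr rfl fun i hi => by simp [gtZero, Finset.mem_range.1 hi]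
  rw [this]
  simp [gtZero]
  ring

theorem erase_inl_disjSum (s t : Finset ℕ) (j : ℕ) :
    (s.disjSum t).erase (.inl j) = (s.erase j).disjSum t := by
  ext (a | a) <;> simp

theorem erase_inr_disjSum (s t : Finset ℕ) (j : ℕ) :
    (s.disjSum t).erase (.inr j) = s.disjSum (t.erase j) := by
  ext (a | a) <;> simp

theorem residue_inl (p : ℕ → ℕ → ℤ) {r j : ℕ} (hj : j < r + 1) :
    (gtZero p r (.inl j) - gtPole p (r + 1) (.inl j)) *
      ∏ b ∈ ((Finset.range (r + 1)).disjSum (Finset.range (r + 1))).erase (.inl j),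
        ((gtZero p r b - gtPole p (r + 1) (.inl j)) /
          (gtPole p (r + 1) b - gtPole p (r + 1) (.inl j))) = raiseSq p (r + 1) j := by
  have hj' : j ∈ Finset.range (r + 1) := Finset.mem_range.2 hj
  have hp := prod_gtZero p r (gtL p (r + 1) j)
  rw [← Finset.mul_prod_erase _ _ hj'] at hp
  have hden : ∏ i ∈ Finset.range (r + 1), (gtL p (r + 1) i - 1 - gtL p (r + 1) j) =
      -∏ i ∈ (Finset.range (r + 1)).erase j, (gtL p (r + 1) i - gtL p (r + 1) j - 1) := by
    rw [← Finset.mul_prod_erase _ _ hj', sub_right_comm, sub_self, zero_sub, neg_one_mul]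
    congr 1
    exact Finset.prod_congr rfl fun i _ => by ring
  have hq : ∏ i ∈ Finset.range r, (gtL p r i - 1 - gtL p (r + 1) j) =
      ∏ i ∈ Finset.range r, (gtL p r i - gtL p (r + 1) j - 1) :=
    Finset.prod_congr rfl fun i _ => by ring
  rw [erase_inl_disjSum, Finset.prod_disjSum, Finset.prod_div_distrib, Finset.prod_div_distrib]
  simp only [gtPole, Sum.elim_inl, Sum.elim_inr]
  rw [div_mul_div_comm, ← mul_div_assoc, ← mul_assoc, hp, hden, raiseSq, Finset.prod_mul_distrib,
    mul_neg, div_neg, neg_div, hq]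
  rfl

theorem residue_inr (p : ℕ → ℕ → ℤ) {r j : ℕ} (hj : j < r + 1) :
    (gtZero p r (.inr j) - gtPole p (r + 1) (.inr j)) *
      ∏ b ∈ ((Finset.range (r + 1)).disjSum (Finset.range (r + 1))).erase (.inr j),
        ((gtZero p r b - gtPole p (r + 1) (.inr j)) /
          (gtPole p (r + 1) b - gtPole p (r + 1) (.inr j))) = -lowerSq p (r + 1) j := by
  have hj' : j ∈ Finset.range (r + 1) := Finset.mem_range.2 hj
  have hp := prod_gtZero p r (gtL p (r + 1) j - 1)
  rw [← Finset.mul_prod_erase _ (fun i => gtZero p r (.inr i) - _) hj'] at hp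
  have hden : ∏ i ∈ Finset.range (r + 1), (gtL p (r + 1) i - (gtL p (r + 1) j - 1)) =
      ∏ i ∈ (Finset.range (r + 1)).erase j, (gtL p (r + 1) i - gtL p (r + 1) j + 1) := by
    rw [← Finset.mul_prod_erase _ _ hj', sub_sub_cancel, one_mul]
    exact Finset.prod_congr rfl fun i _ => by ring
  have hq : ∏ i ∈ Finset.range r, (gtL p r i - 1 - (gtL p (r + 1) j - 1)) =
      ∏ i ∈ Finset.range r, (gtL p r i - gtL p (r + 1) j) :=
    Finset.prod_congr rfl fun i _ => by ring
  have hq' : ∏ i ∈ Finset.range (r + 1 + 1), (gtL p (r + 1 + 1) i - (gtL p (r + 1) j - 1)) =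
      ∏ i ∈ Finset.range (r + 1 + 1), (gtL p (r + 1 + 1) i - gtL p (r + 1) j + 1) :=
    Finset.prod_congr rfl fun i _ => by ring
  have hd' : ∏ i ∈ (Finset.range (r + 1)).erase j,
        (gtL p (r + 1) i - 1 - (gtL p (r + 1) j - 1)) =
      ∏ i ∈ (Finset.range (r + 1)).erase j, (gtL p (r + 1) i - gtL p (r + 1) j) :=
    Finset.prod_congr rfl fun i _ => by ring
  rw [erase_inr_disjSum, Finset.prod_disjSum, Finset.prod_div_distrib, Finset.prod_div_distrib]
  simp only [gtPole, Sum.elim_inl, Sum.elim_inr]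
  rw [div_mul_div_comm, ← mul_div_assoc, mul_left_comm, hp, hden, hd', lowerSq,
    Finset.prod_mul_distrib, neg_div, neg_neg, hq, hq']
  rfl

namespace IsGTPattern

variable {n : ℕ} {m : Fin n → ℤ} {p : ℕ → ℕ → ℤ}

theorem gtL_lt (h : IsGTPattern m p) {k i j : ℕ} (hk : k < n) (hij : i < j) (hj : j < k) :
    gtL p k j < gtL p k i := by
  have h1 := h.row_antitone hk hij.le hj
  have : p k j - (j : ℤ) < p k i - i := by omega
  unfold gtL
  exact_mod_cast this

/-- A double pole only occurs when two neighbouring entries of the row agree; then the entries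
above and below that are squeezed between them cancel it. -/
theorem gtZero_eq_gtPole (h : IsGTPattern m p) {r : ℕ} (hr : r + 1 < n) {a b : ℕ ⊕ ℕ}
    (ha : a ∈ (Finset.range (r + 1)).disjSum (Finset.range (r + 1)))
    (hb : b ∈ (Finset.range (r + 1)).disjSum (Finset.range (r + 1)))
    (hab : a ≠ b) (heq : gtPole p (r + 1) a = gtPole p (r + 1) b) :
    gtZero p r a = gtPole p (r + 1) a := by
  have inj : ∀ i i', i < r + 1 → i' < r + 1 → gtL p (r + 1) i = gtL p (r + 1) i' → i = i' := by
    intro i i' hi hi' hl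
    rcases lt_trichotomy i i' with hlt | heq | hlt
    · exact absurd hl (h.gtL_lt hr hlt hi').ne'
    · exact heq
    · exact absurd hl (h.gtL_lt hr hlt hi).ne
  have adj : ∀ i i', i < r + 1 → i' < r + 1 → gtL p (r + 1) i = gtL p (r + 1) i' - 1 →
      i = i' + 1 ∧ p (r + 1) i = p (r + 1) i' := by
    intro i i' hi hi' hl
    have hl' : p (r + 1) i - (i : ℤ) = p (r + 1) i' - i' - 1 := by
      unfold gtL at hl; exact_mod_cast hl
    rcases le_or_gt i i' with hle | hlt
    · have := h.row_antitone hr hle hi'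
      omega
    · have := h.row_antitone hr (show i' + 1 ≤ i by omega) hi
      have := h.row_succ_le hr (i := i') (by omega)
      omega
  rcases a with i | i <;> rcases b with i' | i' <;>
    simp only [Finset.inl_mem_disjSum, Finset.inr_mem_disjSum, Finset.mem_range] at ha hb <;>
    simp only [gtPole, Sum.elim_inl, Sum.elim_inr] at heq
  · exact absurd (congrArg Sum.inl (inj i i' ha hb heq)) hab
  · obtain ⟨rfl, hp⟩ := adj i i' ha hb heq
    have h1 := h.le_upper (r + 1) (i' + 1) hr ha
    have h2 := h.lower_le (r + 1) i' hr hb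
    have : p (r + 1 + 1) (i' + 1) = p (r + 1) (i' + 1) := by omega
    simp [gtZero, gtPole, gtL, this]
  · obtain ⟨rfl, hp⟩ := adj i' i hb ha heq.symm
    have h1 := h.le_upper r i (by omega) (by omega)
    have h2 := h.lower_le r i (by omega) (by omega)
    have : p r i = p (r + 1) i := by omega
    have hi : i < r := by omega
    simp [gtZero, gtPole, gtL, this, hi]
  · exact absurd (congrArg Sum.inr (inj i i' ha hb (by linarith))) hab

/-- The diagonal part of the relation `[E, F] = H`. -/
theorem sum_lowerSq_sub_raiseSq (h : IsGTPattern m p) {k : ℕ} (hk : 1 ≤ k) (hkn : k < n) :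
    ∑ j ∈ Finset.range k, (lowerSq p k j - raiseSq p k j) =
      (gtWeight p (k - 1) - gtWeight p k : ℤ) := by
  obtain ⟨r, rfl⟩ : ∃ r, k = r + 1 := ⟨k - 1, by omega⟩
  have key := sum_prod_div ((Finset.range (r + 1)).disjSum (Finset.range (r + 1)))
    (gtPole p (r + 1)) (gtZero p r) fun a ha b hb hab heq => h.gtZero_eq_gtPole hkn ha hb hab heq
  rw [Finset.sum_disjSum, Finset.sum_disjSum,
    Finset.sum_congr rfl fun j hj => residue_inl p (Finset.mem_range.1 hj),
    Finset.sum_congr rfl fun j hj => residue_inr p (Finset.mem_range.1 hj)] at key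
  rw [Finset.sum_neg_distrib] at key
  rw [Finset.sum_sub_distrib]
  have e1 : ∑ i ∈ Finset.range (r + 1), (gtZero p r (.inl i) - gtPole p (r + 1) (.inl i)) =
      ∑ i ∈ Finset.range (r + 1), (p (r + 1 + 1) i : ℝ) -
        ∑ i ∈ Finset.range (r + 1), (p (r + 1) i : ℝ) := by
    rw [← Finset.sum_sub_distrib]
    exact Finset.sum_congr rfl fun i _ => by simp [gtZero, gtPole, gtL]
  have e2 : ∑ i ∈ Finset.range (r + 1), (gtZero p r (.inr i) - gtPole p (r + 1) (.inr i)) =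
      ∑ i ∈ Finset.range r, (p r i : ℝ) + p (r + 1 + 1) (r + 1) -
        ∑ i ∈ Finset.range (r + 1), (p (r + 1) i : ℝ) := by
    rw [Finset.sum_range_succ, Finset.sum_range_succ]
    have : ∑ i ∈ Finset.range r, (gtZero p r (.inr i) - gtPole p (r + 1) (.inr i)) =
        ∑ i ∈ Finset.range r, (p r i : ℝ) - ∑ i ∈ Finset.range r, (p (r + 1) i : ℝ) := by
      rw [← Finset.sum_sub_distrib]
      exact Finset.sum_congr rfl fun i hi => by
        simp [gtZero, gtPole, gtL, Finset.mem_range.1 hi]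
    rw [this]
    simp [gtZero, gtPole, gtL]
    ring
  rw [e1, e2] at key
  simp only [gtWeight, Nat.add_sub_cancel]
  rw [Finset.sum_range_succ _ (r + 1)]
  push_cast
  linarith

/-- The factors of the residue at the pole `l_{j,k}` are positive one by one: the zero with the same
index lies to the right of this pole, and for any other index the zero and the pole lie on the same
side of it. -/
theorem raiseSq_pos (h : IsGTPattern m p) {k j : ℕ} (hk : k < n) (hj : j < k)
    (hs : IsGTPattern m (gtShift p k j 1)) : 0 < raiseSq p k j := by
  obtain ⟨r, rfl⟩ : ∃ r, k = r + 1 := ⟨k - 1, by omega⟩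
  obtain ⟨s1, s2⟩ := (h.gtShift_one_iff hk hj).1 hs
  have cast : ∀ {a b : ℤ} {c d : ℕ}, a - c < b - d → (a : ℝ) - c < (b : ℝ) - d := by
    intro a b c d h; exact_mod_cast h
  have quot : ∀ {a b c d : ℝ}, (c < a ∧ d < b) ∨ (a < c ∧ b < d) → 0 < (a - c) / (b - d) := by
    rintro a b c d (⟨h1, h2⟩ | ⟨h1, h2⟩)
    · exact div_pos (sub_pos.2 h1) (sub_pos.2 h2)
    · exact div_pos_of_neg_of_neg (sub_neg.2 h1) (sub_neg.2 h2)
  rw [← residue_inl p hj]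
  refine mul_pos (sub_pos.2 (cast (by omega))) (Finset.prod_pos fun b hb => ?_)
  have hb0 := Finset.ne_of_mem_erase hb
  have hb1 := Finset.mem_of_mem_erase hb
  rcases b with i | i
  · have hi : i < r + 1 := by simpa using hb1
    have hij : i ≠ j := fun h => hb0 (congrArg _ h)
    simp only [gtZero, gtPole, Sum.elim_inl, gtL]
    refine quot ?_
    rcases lt_or_gt_of_ne hij with hlt | hlt
    · left
      have a1 := h.le_upper (r + 1) i hk hi
      have a2 := h.row_antitone hk hlt.le hj
      constructor <;> refine cast ?_ <;> omega
    · right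
      obtain ⟨i, rfl⟩ : ∃ i', i = i' + 1 := ⟨i - 1, by omega⟩
      have a1 := h.lower_le (r + 1) i hk (by omega)
      have a2 := h.row_antitone hk (show j ≤ i by omega) (by omega)
      have a3 := h.row_antitone hk hlt.le hi
      constructor <;> refine cast ?_ <;> omega
  · have hi : i < r + 1 := by simpa using hb1
    simp only [gtZero, gtPole, Sum.elim_inl, Sum.elim_inr, gtL]
    have shift : ∀ a : ℤ, (a : ℝ) - (i : ℝ) - 1 = (a : ℝ) - ((i + 1 : ℕ) : ℝ) := by
      intro a; push_cast; ring
    simp only [shift]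
    split_ifs with hir
    · refine quot ?_
      have a1 := h.le_upper r i (by omega) hir
      rcases lt_or_ge i j with hlt | hge
      · left
        have a2 := h.lower_le r i (by omega) hir
        have a3 := h.row_antitone hk (show i + 1 ≤ j by omega) hj
        have a4 := s2 (by omega)
        by_cases hij : i + 1 = j
        · subst hij
          simp only [Nat.add_sub_cancel] at a4
          constructor <;> refine cast ?_ <;> omega
        · constructor <;> refine cast ?_ <;> omega
      · right
        have a2 := h.row_antitone hk hge hi
        constructor <;> refine cast ?_ <;> omega
    · refine quot ?_
      right
      obtain rfl : i = r := by omega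
      have a1 := h.lower_le (i + 1) i hk hi
      have a2 := h.row_antitone hk (show j ≤ i by omega) hi
      constructor <;> refine cast ?_ <;> omega

theorem raiseSq_eq_zero (h : IsGTPattern m p) {k j : ℕ} (hk : k < n) (hj : j < k)
    (hs : ¬ IsGTPattern m (gtShift p k j 1)) : raiseSq p k j = 0 := by
  rw [h.gtShift_one_iff hk hj] at hs
  have h1 := h.le_upper k j hk hj
  rcases eq_or_lt_of_le h1 with heq | hlt
  · have : ∏ i ∈ Finset.range (k + 1), (gtL p (k + 1) i - gtL p k j) = 0 :=
      Finset.prod_eq_zero (i := j) (by simp; omega) (by simp [gtL, heq])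
    simp [raiseSq, this]
  · have hj1 : 1 ≤ j := by by_contra hc; exact hs ⟨hlt, fun h => absurd h hc⟩
    obtain ⟨k, rfl⟩ : ∃ k', k = k' + 1 := ⟨k - 1, by omega⟩
    obtain ⟨j, rfl⟩ : ∃ j', j = j' + 1 := ⟨j - 1, by omega⟩
    have h2 := h.lower_le k j (by omega) (by omega)
    have heq : p (k + 1) (j + 1) = p k j := by
      by_contra hne
      exact hs ⟨hlt, fun _ => lt_of_le_of_ne h2 hne⟩
    have : ∏ i ∈ Finset.range k, (gtL p k i - gtL p (k + 1) (j + 1) - 1) = 0 :=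
      Finset.prod_eq_zero (i := j) (by simp; omega) (by simp [gtL, heq])
    simp [raiseSq, this]

theorem lowerSq_eq_zero (h : IsGTPattern m p) {k j : ℕ} (hk : k < n) (hj : j < k)
    (hs : ¬ IsGTPattern m (gtShift p k j (-1))) : lowerSq p k j = 0 := by
  rw [h.gtShift_neg_one_iff hk hj] at hs
  have h1 := h.lower_le k j hk hj
  rcases eq_or_lt_of_le h1 with heq | hlt
  · have : ∏ i ∈ Finset.range (k + 1), (gtL p (k + 1) i - gtL p k j + 1) = 0 :=
      Finset.prod_eq_zero (i := j + 1) (by simp; omega) (by simp [gtL, heq])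
    simp [lowerSq, this]
  · have hj1 : j + 1 < k := by by_contra hc; exact hs ⟨hlt, fun h => absurd h hc⟩
    obtain ⟨k, rfl⟩ : ∃ k', k = k' + 1 := ⟨k - 1, by omega⟩
    have h2 := h.le_upper k j (by omega) (by omega)
    have heq : p k j = p (k + 1) j := by
      by_contra hne
      exact hs ⟨hlt, fun _ => lt_of_le_of_ne h2 hne⟩
    have : ∏ i ∈ Finset.range k, (gtL p k i - gtL p (k + 1) j) = 0 :=
      Finset.prod_eq_zero (i := j) (by simp; omega) (by simp [gtL, heq])
    simp [lowerSq, this]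

theorem raiseSq_nonneg (h : IsGTPattern m p) {k j : ℕ} (hk : k < n) (hj : j < k) :
    0 ≤ raiseSq p k j := by
  by_cases hs : IsGTPattern m (gtShift p k j 1)
  · exact (h.raiseSq_pos hk hj hs).le
  · exact (h.raiseSq_eq_zero hk hj hs).ge

theorem lowerSq_nonneg (h : IsGTPattern m p) {k j : ℕ} (hk : k < n) (hj : j < k) :
    0 ≤ lowerSq p k j := by
  by_cases hs : IsGTPattern m (gtShift p k j (-1))
  · rw [← raiseSq_gtShift_neg p (by omega)]
    exact hs.raiseSq_nonneg hk hj
  · exact (h.lowerSq_eq_zero hk hj hs).ge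

theorem gtRaiseCoeff_eq_zero (h : IsGTPattern m p) {k j : ℕ} (hk : k < n) (hj : j < k)
    (hs : ¬ IsGTPattern m (gtShift p k j 1)) : gtRaiseCoeff p k j = 0 :=
  (congrArg Real.sqrt (h.raiseSq_eq_zero hk hj hs)).trans Real.sqrt_zero

theorem gtLowerCoeff_eq_zero (h : IsGTPattern m p) {k j : ℕ} (hk : k < n) (hj : j < k)
    (hs : ¬ IsGTPattern m (gtShift p k j (-1))) : gtLowerCoeff p k j = 0 :=
  (congrArg Real.sqrt (h.lowerSq_eq_zero hk hj hs)).trans Real.sqrt_zero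

/-- The two ways to raise one entry and lower another have the same coefficient. -/
theorem coeff_comm (h : IsGTPattern m p) {k l i j : ℕ} (hk : k < n) (hl : l < n)
    (hj : j < k) (hi : i < l) (hne : k ≠ l ∨ j ≠ i) :
    gtLowerCoeff p l i * gtRaiseCoeff (gtShift p l i (-1)) k j =
      gtRaiseCoeff p k j * gtLowerCoeff (gtShift p k j 1) l i := by
  have := raiseSq_mul_lowerSq_comm p (by omega) (by omega) hj hi hne
  change √(lowerSq p l i) * √(raiseSq _ k j) = √(raiseSq p k j) * √(lowerSq _ l i)
  rw [← Real.sqrt_mul (h.lowerSq_nonneg hl hi), ← Real.sqrt_mul (h.raiseSq_nonneg hk hj), this]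

end IsGTPattern
end Patterns

/-! ### The Gelfand–Tsetlin operators -/

section Operators

variable {n : ℕ} {m : Fin n → ℤ}

theorem gtVec_val (ξ : GTPattern m) : gtVec m ξ.1 = Finsupp.single ξ 1 := by
  simp [gtVec, ξ.2]

theorem gtVec_of_not {p : ℕ → ℕ → ℤ} (h : ¬ IsGTPattern m p) : gtVec m p = 0 := by
  simp [gtVec, h]

theorem hom_ext_gtVec {M : Type*} [AddCommMonoid M] [Module ℂ M] {φ ψ : GTSpace m →ₗ[ℂ] M}
    (h : ∀ p, IsGTPattern m p → φ (gtVec m p) = ψ (gtVec m p)) : φ = ψ := by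
  refine Finsupp.lhom_ext fun ξ c => ?_
  have : Finsupp.single ξ c = c • gtVec m ξ.1 := by simp [gtVec_val]
  rw [this, map_smul, map_smul, h ξ.1 ξ.2]

theorem gtRaise_gtVec {p : ℕ → ℕ → ℤ} (h : IsGTPattern m p) (k : ℕ) :
    gtRaise m k (gtVec m p) =
      ∑ j ∈ Finset.range k, (gtRaiseCoeff p k j : ℂ) • gtVec m (gtShift p k j 1) := by
  rw [gtVec_val ⟨p, h⟩, gtRaise, Finsupp.linearCombination_single, one_smul]

theorem gtLower_gtVec {p : ℕ → ℕ → ℤ} (h : IsGTPattern m p) (k : ℕ) :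
    gtLower m k (gtVec m p) =
      ∑ j ∈ Finset.range k, (gtLowerCoeff p k j : ℂ) • gtVec m (gtShift p k j (-1)) := by
  rw [gtVec_val ⟨p, h⟩, gtLower, Finsupp.linearCombination_single, one_smul]

theorem gtDiag_gtVec (p : ℕ → ℕ → ℤ) (i : ℕ) :
    gtDiag m i (gtVec m p) = (gtWeight p i : ℂ) • gtVec m p := by
  by_cases h : IsGTPattern m p
  · rw [gtVec_val ⟨p, h⟩, gtDiag, Finsupp.linearCombination_single, one_smul]
    simp
  · simp [gtVec_of_not h]

theorem gtRaise_gtLower_gtVec {p : ℕ → ℕ → ℤ} (h : IsGTPattern m p) {k l : ℕ} (hl : l < n) :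
    gtRaise m k (gtLower m l (gtVec m p)) = ∑ j ∈ Finset.range k, ∑ i ∈ Finset.range l,
      ((gtLowerCoeff p l i * gtRaiseCoeff (gtShift p l i (-1)) k j : ℝ) : ℂ) •
        gtVec m (gtShift (gtShift p l i (-1)) k j 1) := by
  rw [gtLower_gtVec h, map_sum, Finset.sum_comm]
  refine Finset.sum_congr rfl fun i hi => ?_
  rw [map_smul]
  by_cases hs : IsGTPattern m (gtShift p l i (-1))
  · rw [gtRaise_gtVec hs, Finset.smul_sum]
    simp [mul_smul]
  · simp [h.gtLowerCoeff_eq_zero hl (Finset.mem_range.1 hi) hs]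

theorem gtLower_gtRaise_gtVec {p : ℕ → ℕ → ℤ} (h : IsGTPattern m p) {k l : ℕ} (hk : k < n) :
    gtLower m l (gtRaise m k (gtVec m p)) = ∑ j ∈ Finset.range k, ∑ i ∈ Finset.range l,
      ((gtRaiseCoeff p k j * gtLowerCoeff (gtShift p k j 1) l i : ℝ) : ℂ) •
        gtVec m (gtShift (gtShift p l i (-1)) k j 1) := by
  rw [gtRaise_gtVec h, map_sum]
  refine Finset.sum_congr rfl fun j hj => ?_
  rw [map_smul]
  by_cases hs : IsGTPattern m (gtShift p k j 1)
  · rw [gtLower_gtVec hs, Finset.smul_sum]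
    simp [mul_smul, gtShift_comm p k j]
  · simp [h.gtRaiseCoeff_eq_zero hk (Finset.mem_range.1 hj) hs]

theorem gtRaise_gtLower_sub_of_ne {k l : ℕ} (hk : k < n) (hl : l < n) (hkl : k ≠ l)
    {p : ℕ → ℕ → ℤ} (h : IsGTPattern m p) :
    gtRaise m k (gtLower m l (gtVec m p)) - gtLower m l (gtRaise m k (gtVec m p)) = 0 := by
  rw [gtRaise_gtLower_gtVec h hl, gtLower_gtRaise_gtVec h hk, sub_eq_zero]
  refine Finset.sum_congr rfl fun j hj => Finset.sum_congr rfl fun i hi => ?_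
  rw [h.coeff_comm hk hl (Finset.mem_range.1 hj) (Finset.mem_range.1 hi) (Or.inl hkl)]

theorem gtRaise_gtLower_sub_self {k : ℕ} (hk : 1 ≤ k) (hkn : k < n)
    {p : ℕ → ℕ → ℤ} (h : IsGTPattern m p) :
    gtRaise m k (gtLower m k (gtVec m p)) - gtLower m k (gtRaise m k (gtVec m p)) =
      (gtWeight p (k - 1) - gtWeight p k : ℂ) • gtVec m p := by
  rw [gtRaise_gtLower_gtVec h hkn, gtLower_gtRaise_gtVec h hkn, ← Finset.sum_sub_distrib]
  have inner : ∀ j ∈ Finset.range k,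
      (∑ i ∈ Finset.range k,
        ((gtLowerCoeff p k i * gtRaiseCoeff (gtShift p k i (-1)) k j : ℝ) : ℂ) •
          gtVec m (gtShift (gtShift p k i (-1)) k j 1)) -
      ∑ i ∈ Finset.range k,
        ((gtRaiseCoeff p k j * gtLowerCoeff (gtShift p k j 1) k i : ℝ) : ℂ) •
          gtVec m (gtShift (gtShift p k i (-1)) k j 1) =
      ((lowerSq p k j - raiseSq p k j : ℝ) : ℂ) • gtVec m p := by
    intro j hj
    have hj' := Finset.mem_range.1 hj
    rw [← Finset.sum_sub_distrib, Finset.sum_eq_single j]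
    · have e1 : gtLowerCoeff p k j * gtRaiseCoeff (gtShift p k j (-1)) k j = lowerSq p k j := by
        change √(lowerSq p k j) * √(raiseSq _ k j) = _
        rw [raiseSq_gtShift_neg p hk, Real.mul_self_sqrt (h.lowerSq_nonneg hkn hj')]
      have e2 : gtRaiseCoeff p k j * gtLowerCoeff (gtShift p k j 1) k j = raiseSq p k j := by
        change √(raiseSq p k j) * √(lowerSq _ k j) = _
        rw [lowerSq_gtShift_one p hk, Real.mul_self_sqrt (h.raiseSq_nonneg hkn hj')]
      rw [e1, e2, ← sub_smul, gtShift_gtShift_neg p k j _ _ (by norm_num), Complex.ofReal_sub]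
    · intro i hi hij
      rw [h.coeff_comm hkn hkn hj' (Finset.mem_range.1 hi) (Or.inr hij.symm), sub_self]
    · intro hc; exact absurd hj hc
  rw [Finset.sum_congr rfl inner, ← Finset.sum_smul, ← Complex.ofReal_sum,
    h.sum_lowerSq_sub_raiseSq hk hkn]
  push_cast
  rfl

theorem sum_gtShift (p : ℕ → ℕ → ℤ) {k j : ℕ} (hj : j < k) (d : ℤ) (l : ℕ) :
    ∑ i ∈ Finset.range l, gtShift p k j d l i =
      ∑ i ∈ Finset.range l, p l i + if l = k then d else 0 := by
  split_ifs with h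
  · subst h
    rw [← Finset.add_sum_erase _ _ (Finset.mem_range.2 hj),
      ← Finset.add_sum_erase _ (p l) (Finset.mem_range.2 hj), gtShift_same,
      Finset.sum_congr rfl fun i hi => gtShift_of_ne p d (Or.inr (Finset.ne_of_mem_erase hi))]
    ring
  · rw [Finset.sum_congr rfl fun i _ => gtShift_of_ne p d (Or.inl h), add_zero]

theorem gtWeight_gtShift (p : ℕ → ℕ → ℤ) {k j : ℕ} (hj : j < k) (d : ℤ) (i : ℕ) :
    gtWeight (gtShift p k j d) i =
      gtWeight p i + ((if i + 1 = k then d else 0) - if i = k then d else 0) := by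
  simp only [gtWeight, sum_gtShift p hj]
  ring

theorem gtDiag_gtRaise_sub (i k : ℕ) {p : ℕ → ℕ → ℤ} (h : IsGTPattern m p) :
    gtDiag m i (gtRaise m k (gtVec m p)) - gtRaise m k (gtDiag m i (gtVec m p)) =
      ((if i + 1 = k then 1 else 0) - (if i = k then 1 else 0) : ℂ) • gtRaise m k (gtVec m p) := by
  rw [gtDiag_gtVec, map_smul, gtRaise_gtVec h, map_sum, Finset.smul_sum, Finset.smul_sum,
    ← Finset.sum_sub_distrib]
  refine Finset.sum_congr rfl fun j hj => ?_
  rw [map_smul, gtDiag_gtVec, gtWeight_gtShift p (Finset.mem_range.1 hj), smul_smul, smul_smul,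
    smul_smul, ← sub_smul]
  congr 1
  push_cast
  ring

theorem gtDiag_gtLower_sub (i k : ℕ) {p : ℕ → ℕ → ℤ} (h : IsGTPattern m p) :
    gtDiag m i (gtLower m k (gtVec m p)) - gtLower m k (gtDiag m i (gtVec m p)) =
      ((if i = k then 1 else 0) - (if i + 1 = k then 1 else 0) : ℂ) • gtLower m k (gtVec m p) := by
  rw [gtDiag_gtVec, map_smul, gtLower_gtVec h, map_sum, Finset.smul_sum, Finset.smul_sum,
    ← Finset.sum_sub_distrib]
  refine Finset.sum_congr rfl fun j hj => ?_
  rw [map_smul, gtDiag_gtVec, gtWeight_gtShift p (Finset.mem_range.1 hj), smul_smul, smul_smul,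
    smul_smul, ← sub_smul]
  congr 1
  push_cast
  split_ifs <;> ring

theorem IsGTPattern.exists_between {p : ℕ → ℕ → ℤ} (h : IsGTPattern m p) {k i : ℕ} (hk : k ≤ n)
    (hi : i < k) : (∃ a, p k i ≤ m a) ∧ ∃ a, m a ≤ p k i := by
  induction hk using Nat.decreasingInduction generalizing i with
  | self => exact ⟨⟨⟨i, hi⟩, (h.top_row ⟨i, hi⟩).le⟩, ⟨⟨i, hi⟩, (h.top_row ⟨i, hi⟩).ge⟩⟩
  | of_succ k hk ih =>
    obtain ⟨a, ha⟩ := (ih (i := i) (by omega)).1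
    obtain ⟨b, hb⟩ := (ih (i := i + 1) (by omega)).2
    exact ⟨⟨a, (h.le_upper k i hk hi).trans ha⟩, ⟨b, hb.trans (h.lower_le k i hk hi)⟩⟩

instance finite_gtPattern : Finite (GTPattern m) := by
  let C : ℤ := ∑ a, |m a|
  have hC : ∀ a, |m a| ≤ C := fun a =>
    Finset.single_le_sum (f := fun a => |m a|) (fun a _ => abs_nonneg _) (Finset.mem_univ a)
  have bound : ∀ (ξ : GTPattern m) (k i : ℕ), ξ.1 k i ∈ Set.Icc (-C) C := by
    intro ξ k i
    by_cases hki : n < k ∨ k ≤ i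
    · rw [ξ.2.zeros k i hki]
      have : 0 ≤ C := Finset.sum_nonneg fun a _ => abs_nonneg _
      exact ⟨by omega, this⟩
    · obtain ⟨⟨a, ha⟩, ⟨b, hb⟩⟩ := ξ.2.exists_between (k := k) (i := i) (by omega) (by omega)
      have h1 := abs_le.1 (hC a)
      have h2 := abs_le.1 (hC b)
      exact ⟨by omega, by omega⟩
  let F : GTPattern m → (Fin (n + 1) → Fin n → Set.Icc (-C) C) :=
    fun ξ k i => ⟨ξ.1 k i, bound ξ k i⟩
  refine Finite.of_injective F fun ξ η h => Subtype.ext (funext fun k => funext fun i => ?_)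
  by_cases hki : n < k ∨ k ≤ i
  · rw [ξ.2.zeros k i hki, η.2.zeros k i hki]
  · exact congrArg Subtype.val (congrFun (congrFun h ⟨k, by omega⟩) ⟨i, by omega⟩)

attribute [local instance 100] LieRing.ofAssociativeRing

theorem isChevalleyFamily_gt (m : Fin n → ℤ) :
    IsChevalleyFamily (L := Module.End ℂ (GTSpace m)) n
      (fun i => gtRaise m (i + 1)) (fun i => gtLower m (i + 1)) (gtDiag m) where
  lie_e_f i j hi hj := by
    refine hom_ext_gtVec fun p h => ?_
    rw [LieRing.of_associative_ring_bracket, LinearMap.sub_apply, Module.End.mul_apply,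
      Module.End.mul_apply]
    by_cases hij : i = j
    · subst hij
      rw [gtRaise_gtLower_sub_self (by omega) hi h, if_pos rfl, LinearMap.sub_apply, gtDiag_gtVec,
        gtDiag_gtVec, sub_smul, Nat.add_sub_cancel]
    · rw [gtRaise_gtLower_sub_of_ne hi hj (by omega) h, if_neg hij, LinearMap.zero_apply]
  lie_H_e i j hi hj := by
    refine hom_ext_gtVec fun p h => ?_
    rw [LieRing.of_associative_ring_bracket, LinearMap.sub_apply, Module.End.mul_apply,
      Module.End.mul_apply, gtDiag_gtRaise_sub i _ h, LinearMap.smul_apply]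
    simp only [Nat.add_right_cancel_iff]
  lie_H_f i j hi hj := by
    refine hom_ext_gtVec fun p h => ?_
    rw [LieRing.of_associative_ring_bracket, LinearMap.sub_apply, Module.End.mul_apply,
      Module.End.mul_apply, gtDiag_gtLower_sub i _ h, LinearMap.smul_apply]
    simp only [Nat.add_right_cancel_iff]
  lie_H_H i j hi hj := by
    refine hom_ext_gtVec fun p h => ?_
    rw [LieRing.of_associative_ring_bracket, LinearMap.sub_apply, Module.End.mul_apply,
      Module.End.mul_apply, gtDiag_gtVec, gtDiag_gtVec, map_smul, map_smul, gtDiag_gtVec,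
      gtDiag_gtVec, smul_comm, sub_self, LinearMap.zero_apply]

/-- The endomorphism by which a matrix acts on the space of patterns. -/
noncomputable def gtRep (m : Fin n → ℤ) :
    Matrix (Fin n) (Fin n) ℂ →ₗ[ℂ] Module.End ℂ (GTSpace m) :=
  unitVectorMap n (fun i => gtRaise m (i + 1)) (fun i => gtLower m (i + 1)) (gtDiag m)

/-- The Gelfand–Tsetlin representation of `sl_n`. -/
noncomputable def gtLieHom (m : Fin n → ℤ) : SLn n →ₗ⁅ℂ⁆ Module.End ℂ (GTSpace m) where
  toLinearMap := gtRep m ∘ₗ (LieAlgebra.SpecialLinear.sl (Fin n) ℂ).toSubmodule.subtype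
  map_lie' {x y} := (isChevalleyFamily_gt m).unitVectorMap_lie x.1 y.1

theorem gtRep_single_succ (m : Fin n → ℤ) {i j : Fin n} (h : (i : ℕ) + 1 = j) :
    gtRep m (Matrix.single i j 1) = gtRaise m j := by
  have := unitVector_add (e := fun i => gtRaise m (i + 1)) (f := fun i => gtLower m (i + 1))
    (H := gtDiag m) i 0
  rw [gtRep, unitVectorMap_single, ← h, this, rootVector]

theorem gtRep_succ_single (m : Fin n → ℤ) {i j : Fin n} (h : (i : ℕ) + 1 = j) :
    gtRep m (Matrix.single j i 1) = gtLower m j := by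
  have := unitVector_add' (e := fun i => gtRaise m (i + 1)) (f := fun i => gtLower m (i + 1))
    (H := gtDiag m) i 0
  rw [gtRep, unitVectorMap_single, ← h, this, rootVector, Pi.neg_apply]
  exact neg_neg (gtLower m (i + 1))

theorem gtRep_single_self (m : Fin n → ℤ) (i : Fin n) :
    gtRep m (Matrix.single i i 1) = gtDiag m i := by
  rw [gtRep, unitVectorMap_single, unitVector_self]

/-- A vector killed by the simple raising operators is killed by all positive root vectors. -/
theorem rootVector_apply_eq_zero {e : ℕ → Module.End ℂ (GTSpace m)} {v : GTSpace m} {i d : ℕ}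
    (h : ∀ k, k ≤ i + d → e k v = 0) : rootVector e i d v = 0 := by
  induction d with
  | zero => exact h i le_rfl
  | succ d ih =>
    rw [rootVector, LieRing.of_associative_ring_bracket, LinearMap.sub_apply, Module.End.mul_apply,
      Module.End.mul_apply, h (i + d + 1) (by omega), ih fun k hk => h k (by omega), map_zero,
      map_zero, sub_zero]

end Operators

/-! ### Raising every pattern to the highest one -/

section Raising

variable {n : ℕ} {m : Fin n → ℤ}

/-- The array obtained from `p` by replacing row `k` with the initial segment of row `k + 1`. -/
def fillRow (p : ℕ → ℕ → ℤ) (k : ℕ) : ℕ → ℕ → ℤ :=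
  fun s i => if s = k ∧ i < k then p (k + 1) i else p s i

theorem gtRaise_eq_zero_of_filled {p : ℕ → ℕ → ℤ} {k : ℕ} (hk : k < n)
    (hp : ∀ j, j < k → p k j = p (k + 1) j) : gtRaise m k (gtVec m p) = 0 := by
  by_cases h : IsGTPattern m p
  · rw [gtRaise_gtVec h]
    refine Finset.sum_eq_zero fun j hj => ?_
    have hj' := Finset.mem_range.1 hj
    rw [gtVec_of_not, smul_zero]
    rw [h.gtShift_one_iff hk hj']
    have := hp j hj'
    omega
  · rw [gtVec_of_not h, map_zero]

/-- If row `k - 1` leaves room for row `k` to be filled up completely, the power of the raising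
operator that has the right degree does so. -/
theorem gtRaise_pow_gtVec {k : ℕ} (hk : k < n) (d : ℕ) {p : ℕ → ℕ → ℤ} (h : IsGTPattern m p)
    (hroom : ∀ i, i + 1 < k → p (k + 1) (i + 1) ≤ p (k - 1) i)
    (hd : ∑ i ∈ Finset.range k, (p (k + 1) i - p k i) = d) :
    ∃ c : ℝ, 0 < c ∧ (gtRaise m k ^ d) (gtVec m p) = (c : ℂ) • gtVec m (fillRow p k) := by
  induction d generalizing p with
  | zero =>
    have hz : ∀ i ∈ Finset.range k, p (k + 1) i - p k i = 0 :=
      (Finset.sum_eq_zero_iff_of_nonneg fun i hi =>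
        sub_nonneg.2 (h.le_upper k i hk (Finset.mem_range.1 hi))).1 (by simpa using hd)
    have : fillRow p k = p := by
      funext s i
      unfold fillRow
      split_ifs with hc
      · obtain ⟨rfl, hi⟩ := hc
        exact sub_eq_zero.1 (hz i (Finset.mem_range.2 hi))
      · rfl
    exact ⟨1, one_pos, by simp [this]⟩
  | succ d ih =>
    have hfill : ∀ j, j < k → fillRow (gtShift p k j 1) k = fillRow p k := by
      intro j hj
      funext s i
      unfold fillRow
      split_ifs with hc
      · exact gtShift_of_ne _ _ (by omega)
      · rcases eq_or_ne s k with hs | hs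
        · exact gtShift_of_ne _ _ (by omega)
        · exact gtShift_of_ne _ _ (Or.inl hs)
    have step : ∀ j, ∃ c : ℝ, j < k → 0 ≤ c ∧
        (gtRaiseCoeff p k j : ℂ) • (gtRaise m k ^ d) (gtVec m (gtShift p k j 1)) =
          (c : ℂ) • gtVec m (fillRow p k) ∧ (IsGTPattern m (gtShift p k j 1) → 0 < c) := by
      intro j
      by_cases hj : j < k
      swap
      · exact ⟨0, fun hc => absurd hc hj⟩
      by_cases hs : IsGTPattern m (gtShift p k j 1)
      · have hsum : ∑ i ∈ Finset.range k, (gtShift p k j 1 (k + 1) i - gtShift p k j 1 k i) = d := by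
          rw [Finset.sum_sub_distrib, sum_gtShift p hj, if_pos rfl,
            Finset.sum_congr rfl fun i _ => gtShift_of_ne p 1 (k' := k + 1) (j' := i) (by omega)]
          rw [Finset.sum_sub_distrib] at hd
          push_cast at hd
          linarith
        have hroom' : ∀ i, i + 1 < k →
            gtShift p k j 1 (k + 1) (i + 1) ≤ gtShift p k j 1 (k - 1) i := by
          intro i hi
          rw [gtShift_of_ne _ _ (by omega), gtShift_of_ne _ _ (by omega)]
          exact hroom i hi
        obtain ⟨c, hc, hce⟩ := ih hs hroom' hsum
        have ha : 0 < gtRaiseCoeff p k j := Real.sqrt_pos.2 (h.raiseSq_pos hk hj hs)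
        refine ⟨gtRaiseCoeff p k j * c, fun _ => ⟨(mul_pos ha hc).le, ?_, fun _ => mul_pos ha hc⟩⟩
        rw [hce, hfill j hj, smul_smul, Complex.ofReal_mul]
      · refine ⟨0, fun _ => ⟨le_rfl, ?_, fun hc => absurd hc hs⟩⟩
        simp [h.gtRaiseCoeff_eq_zero hk hj hs]
    choose c hc using step
    refine ⟨∑ j ∈ Finset.range k, c j, ?_, ?_⟩
    · -- Some entry of row `k` lies below its upper neighbour, and the room allows to raise it.
      have hne : ∃ j ∈ Finset.range k, 0 < p (k + 1) j - p k j := by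
        by_contra! hcon
        have := Finset.sum_nonpos hcon
        rw [hd] at this
        omega
      obtain ⟨j, hj, hlt⟩ := hne
      have hj' := Finset.mem_range.1 hj
      refine Finset.sum_pos' (fun i hi => (hc i (Finset.mem_range.1 hi)).1) ⟨j, hj, ?_⟩
      refine (hc j hj').2.2 ((h.gtShift_one_iff hk hj').2 ⟨by omega, fun hj1 => ?_⟩)
      have := hroom (j - 1) (by omega)
      rw [Nat.sub_add_cancel hj1] at this
      omega
    · rw [pow_succ, Module.End.mul_apply, gtRaise_gtVec h, map_sum, Complex.ofReal_sum,
        Finset.sum_smul]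
      refine Finset.sum_congr rfl fun j hj => ?_
      rw [map_smul, (hc j (Finset.mem_range.1 hj)).2.1]

theorem gtRaise_pow_gtVec_eq_zero {k : ℕ} (hk : k < n) {d d' : ℕ} {p : ℕ → ℕ → ℤ}
    (h : IsGTPattern m p) (hroom : ∀ i, i + 1 < k → p (k + 1) (i + 1) ≤ p (k - 1) i)
    (hd : ∑ i ∈ Finset.range k, (p (k + 1) i - p k i) = d) (hlt : d < d') :
    (gtRaise m k ^ d') (gtVec m p) = 0 := by
  obtain ⟨c, -, hc⟩ := gtRaise_pow_gtVec hk d h hroom hd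
  obtain ⟨t, rfl⟩ : ∃ t, d' = t + (1 + d) := ⟨d' - d - 1, by omega⟩
  rw [pow_add, pow_add, Module.End.mul_apply, Module.End.mul_apply, hc, pow_one, map_smul,
    gtRaise_eq_zero_of_filled hk, smul_zero, map_zero]
  intro j hj
  simp [fillRow, hj]

/-- The intermediate arrays on the way from `p` to the highest pattern.  The rows up to row `r`
are initial segments of row `K` of `p`, those from row `r + 1` to row `K` are initial segments of
row `K + 1` of `p`, and the other rows are those of `p`. -/
def gtStage (p : ℕ → ℕ → ℤ) (K r : ℕ) : ℕ → ℕ → ℤ :=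
  fun s i => if s ≤ K ∧ i < s then (if s ≤ r then p K i else p (K + 1) i) else p s i

/-- The number of times that row `r` of `gtStage p K r` has to be raised. -/
def gtGap (p : ℕ → ℕ → ℤ) (K r : ℕ) : ℤ := ∑ i ∈ Finset.range r, (p (K + 1) i - p K i)

theorem gtStage_zero_zero (p : ℕ → ℕ → ℤ) : gtStage p 0 0 = p := by
  funext s i
  rw [gtStage, if_neg (by omega)]

theorem gtStage_succ (p : ℕ → ℕ → ℤ) (K : ℕ) : gtStage p (K + 1) (K + 1) = gtStage p K 0 := by
  funext s i
  unfold gtStage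
  by_cases h1 : s ≤ K ∧ i < s
  · rw [if_pos h1, if_pos (by omega), if_pos (by omega), if_neg (by omega)]
  · rw [if_neg h1]
    split_ifs with h2 h3
    · obtain rfl : s = K + 1 := by omega
      rfl
    · omega
    · rfl

theorem IsGTPattern.gtStage {p : ℕ → ℕ → ℤ} (h : IsGTPattern m p) {K r : ℕ} (hK : K < n)
    (hr : r ≤ K) : IsGTPattern m (gtStage p K r) where
  top_row i := by
    rw [_root_.gtStage, if_neg (by omega)]
    exact h.top_row i
  le_upper s i hs hi := by
    have h0 := h.le_upper s i hs hi
    unfold _root_.gtStage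
    by_cases hsK : s ≤ K
    · have h1 := h.le_upper K i hK (by omega)
      rw [if_pos ⟨hsK, hi⟩]
      rcases eq_or_lt_of_le hsK with rfl | hlt
      · rw [if_neg (c := s + 1 ≤ s ∧ i < s + 1) (by omega)]
        split_ifs
        · exact h1
        · exact le_rfl
      · rw [if_pos (c := s + 1 ≤ K ∧ i < s + 1) (by omega)]
        split_ifs <;> omega
    · rw [if_neg (by omega), if_neg (by omega)]
      exact h0
  lower_le s i hs hi := by
    have h0 := h.lower_le s i hs hi
    unfold _root_.gtStage
    by_cases hsK : s ≤ K
    · have h1 := h.lower_le K i hK (by omega)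
      have h2 := h.le_upper K i hK (by omega)
      rw [if_pos (c := s ≤ K ∧ i < s) ⟨hsK, hi⟩]
      rcases eq_or_lt_of_le hsK with rfl | hlt
      · rw [if_neg (by omega)]
        split_ifs <;> omega
      · have h3 := h.le_upper K (i + 1) hK (by omega)
        rw [if_pos (c := s + 1 ≤ K ∧ i + 1 < s + 1) (by omega)]
        have h4 := h.row_succ_le hK (i := i) (by omega)
        split_ifs <;> omega
    · rw [if_neg (by omega), if_neg (by omega)]
      exact h0
  zeros s i hsi := by
    rw [_root_.gtStage, if_neg (by omega)]
    exact h.zeros s i hsi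

theorem fillRow_gtStage (p : ℕ → ℕ → ℤ) {K r : ℕ} (hr : r + 1 ≤ K) :
    fillRow (gtStage p K (r + 1)) (r + 1) = gtStage p K r := by
  funext s i
  unfold fillRow gtStage
  split_ifs <;> first | rfl | omega | skip
  · obtain rfl : K = r + 1 := by omega
    rfl

theorem gtStage_gap (p : ℕ → ℕ → ℤ) {K r : ℕ} (hr : r ≤ K) :
    ∑ i ∈ Finset.range r, (gtStage p K r (r + 1) i - gtStage p K r r i) = gtGap p K r := by
  refine Finset.sum_congr rfl fun i hi => ?_
  have hi' := Finset.mem_range.1 hi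
  unfold gtStage
  rw [if_pos (c := r ≤ K ∧ i < r) ⟨hr, hi'⟩, if_pos le_rfl]
  split_ifs with h1 h2
  · omega
  · rfl
  · obtain rfl : r = K := by omega
    rfl

theorem gtStage_room {p : ℕ → ℕ → ℤ} (h : IsGTPattern m p) {K r : ℕ} (hK : K < n) (hr : r ≤ K)
    (i : ℕ) (hi : i + 1 < r) : gtStage p K r (r + 1) (i + 1) ≤ gtStage p K r (r - 1) i := by
  have h1 := h.lower_le K i hK (by omega)
  unfold gtStage
  rw [if_pos (c := r - 1 ≤ K ∧ i < r - 1) (by omega), if_pos (c := r - 1 ≤ r) (by omega)]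
  split_ifs with h2 h3
  · omega
  · exact h1
  · obtain rfl : r = K := by omega
    exact h1

theorem IsGTPattern.gtGap_nonneg {p : ℕ → ℕ → ℤ} (h : IsGTPattern m p) {K r : ℕ} (hK : K < n)
    (hr : r ≤ K) : 0 ≤ gtGap p K r :=
  Finset.sum_nonneg fun i hi =>
    sub_nonneg.2 (h.le_upper K i hK (by have := Finset.mem_range.1 hi; omega))

theorem gtStage_last {p : ℕ → ℕ → ℤ} (h : IsGTPattern m p) : gtStage p n n = gtHighestArray m := by
  funext s i
  unfold gtStage gtHighestArray
  split_ifs with h1 h2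
  · exact h.top_row ⟨i, by omega⟩
  · omega
  · exact h.zeros s i (by omega)

/-- The numbers `gtGap` determine a pattern: row by row, starting from the top, they yield the
differences between the entries of neighbouring rows. -/
theorem IsGTPattern.eq_of_gtGap {p q : ℕ → ℕ → ℤ} (hp : IsGTPattern m p) (hq : IsGTPattern m q)
    (hg : ∀ K r, K < n → r ≤ K → gtGap p K r = gtGap q K r) : p = q := by
  have rows : ∀ K, K ≤ n → ∀ i, p K i = q K i := by
    intro K hK
    induction hK using Nat.decreasingInduction with
    | self =>
      intro i
      by_cases hi : i < n
      · exact (hp.top_row ⟨i, hi⟩).trans (hq.top_row ⟨i, hi⟩).symm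
      · rw [hp.zeros n i (by omega), hq.zeros n i (by omega)]
    | of_succ K hK ih =>
      intro i
      by_cases hi : i < K
      · have h1 := hg K i hK hi.le
        have h2 := hg K (i + 1) hK hi
        simp only [gtGap] at h1 h2
        rw [Finset.sum_range_succ, Finset.sum_range_succ, h1, ih i] at h2
        linarith
      · rw [hp.zeros K i (by omega), hq.zeros K i (by omega)]
  funext K i
  by_cases hK : K ≤ n
  · exact rows K hK i
  · rw [hp.zeros K i (by omega), hq.zeros K i (by omega)]

/-- Some operator in `G` sends the patterns of a nonempty part of `S`, any two of which are related
by `Rel`, to positive multiples of the arrays prescribed by `st`, and kills the rest of `S`. -/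
def Selects (G : Submonoid (Module.End ℂ (GTSpace m))) (S : Finset (GTPattern m))
    (st : GTPattern m → ℕ → ℕ → ℤ) (Rel : GTPattern m → GTPattern m → Prop) : Prop :=
  ∃ T ∈ G, ∃ S' ⊆ S, S'.Nonempty ∧
    (∀ ξ ∈ S', ∃ c : ℝ, 0 < c ∧ T (Finsupp.single ξ 1) = (c : ℂ) • gtVec m (st ξ)) ∧
    (∀ ξ ∈ S, ξ ∉ S' → T (Finsupp.single ξ 1) = 0) ∧ ∀ ξ ∈ S', ∀ η ∈ S', Rel ξ η

/-- Among the patterns selected so far, those with the largest exponent `d` can be selected. -/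
theorem Selects.step {G : Submonoid (Module.End ℂ (GTSpace m))} {S : Finset (GTPattern m)}
    {st st' : GTPattern m → ℕ → ℕ → ℤ} {Rel : GTPattern m → GTPattern m → Prop}
    (h : Selects G S st Rel) {E : Module.End ℂ (GTSpace m)} (hE : E ∈ G) (d : GTPattern m → ℕ)
    (hpow : ∀ ξ, ∃ c : ℝ, 0 < c ∧ (E ^ d ξ) (gtVec m (st ξ)) = (c : ℂ) • gtVec m (st' ξ))
    (hzero : ∀ ξ d', d ξ < d' → (E ^ d') (gtVec m (st ξ)) = 0) :
    Selects G S st' fun ξ η => Rel ξ η ∧ d ξ = d η := by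
  obtain ⟨T, hT, S', hS', hne, hsel, hkill, hrel⟩ := h
  obtain ⟨ξ₀, hξ₀, hmax⟩ := S'.exists_max_image d hne
  refine ⟨E ^ d ξ₀ * T, G.mul_mem (G.pow_mem hE _) hT, S'.filter fun ξ => d ξ = d ξ₀,
    (Finset.filter_subset _ _).trans hS', ⟨ξ₀, Finset.mem_filter.2 ⟨hξ₀, rfl⟩⟩, ?_, ?_, ?_⟩
  · intro ξ hξ
    obtain ⟨hξS, hξd⟩ := Finset.mem_filter.1 hξ
    obtain ⟨c, hc, hce⟩ := hsel ξ hξS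
    obtain ⟨c', hc', hce'⟩ := hpow ξ
    refine ⟨c * c', mul_pos hc hc', ?_⟩
    rw [Module.End.mul_apply, hce, map_smul, ← hξd, hce', smul_smul, Complex.ofReal_mul]
  · intro ξ hξ hξ'
    rw [Module.End.mul_apply]
    by_cases hξS : ξ ∈ S'
    · obtain ⟨c, -, hce⟩ := hsel ξ hξS
      have hlt : d ξ < d ξ₀ := lt_of_le_of_ne (hmax ξ hξS) fun hd =>
        hξ' (Finset.mem_filter.2 ⟨hξS, hd⟩)
      rw [hce, map_smul, hzero ξ _ hlt, smul_zero]
    · rw [hkill ξ hξ hξS, map_zero]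
  · intro ξ hξ η hη
    obtain ⟨hξS, hξd⟩ := Finset.mem_filter.1 hξ
    obtain ⟨hηS, hηd⟩ := Finset.mem_filter.1 hη
    exact ⟨hrel ξ hξS η hηS, hξd.trans hηd.symm⟩

theorem Selects.mono {G : Submonoid (Module.End ℂ (GTSpace m))} {S : Finset (GTPattern m)}
    {st st' : GTPattern m → ℕ → ℕ → ℤ} {Rel Rel' : GTPattern m → GTPattern m → Prop}
    (h : Selects G S st Rel) (hst : ∀ ξ, st ξ = st' ξ) (hRel : ∀ ξ η, Rel ξ η → Rel' ξ η) :
    Selects G S st' Rel' := by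
  obtain ⟨T, hT, S', hS', hne, hsel, hkill, hrel⟩ := h
  exact ⟨T, hT, S', hS', hne, fun ξ hξ => hst ξ ▸ hsel ξ hξ, hkill,
    fun ξ hξ η hη => hRel _ _ (hrel ξ hξ η hη)⟩

/-- Two patterns have the same gaps in all stages before stage `(K, r)`. -/
def SameGaps (K r : ℕ) (ξ η : GTPattern m) : Prop :=
  ∀ K' r', r' ≤ K' → (K' < K ∨ K' = K ∧ r < r') → gtGap ξ.1 K' r' = gtGap η.1 K' r'

theorem selects_gtStage {G : Submonoid (Module.End ℂ (GTSpace m))}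
    (hG : ∀ k, 1 ≤ k → k < n → gtRaise m k ∈ G) {S : Finset (GTPattern m)} (hS : S.Nonempty)
    {K : ℕ} (hK : K ≤ n) : Selects G S (fun ξ => gtStage ξ.1 K K) (SameGaps K K) := by
  induction K with
  | zero =>
    refine ⟨1, G.one_mem, S, subset_rfl, hS, fun ξ _ => ⟨1, one_pos, ?_⟩,
      fun ξ h h' => absurd h h', fun ξ _ η _ K' r' h1 h2 => by omega⟩
    beta_reduce
    rw [gtStage_zero_zero, gtVec_val, Module.End.one_apply, Complex.ofReal_one, one_smul]
  | succ K ih =>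
    have hKn : K < n := hK
    have down : ∀ t, t ≤ K →
        Selects G S (fun ξ => gtStage ξ.1 K (K - t)) (SameGaps K (K - t)) := by
      intro t
      induction t with
      | zero => exact fun _ => ih hKn.le
      | succ t iht =>
        intro ht
        obtain ⟨r, hr⟩ : ∃ r, K - t = r + 1 := ⟨K - t - 1, by omega⟩
        have h := iht (by omega)
        rw [hr] at h
        have hr' : K - (t + 1) = r := by omega
        rw [hr']
        have hrK : r + 1 ≤ K := by omega
        have toNat : ∀ ξ : GTPattern m,
            ∑ i ∈ Finset.range (r + 1),
              (gtStage ξ.1 K (r + 1) (r + 1 + 1) i - gtStage ξ.1 K (r + 1) (r + 1) i) =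
              ((gtGap ξ.1 K (r + 1)).toNat : ℤ) := by
          intro ξ
          rw [gtStage_gap _ hrK, Int.toNat_of_nonneg (ξ.2.gtGap_nonneg hKn hrK)]
        refine (h.step (st' := fun ξ => gtStage ξ.1 K r) (hG (r + 1) (by omega) (by omega))
          (fun ξ => (gtGap ξ.1 K (r + 1)).toNat) (fun ξ => ?_) (fun ξ d' hd' => ?_)).mono
          (fun ξ => rfl) (fun ξ η hrel K' r' h1 h2 => ?_)
        · rw [← fillRow_gtStage _ hrK]
          exact gtRaise_pow_gtVec (by omega) _ (ξ.2.gtStage hKn hrK)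
            (gtStage_room ξ.2 hKn hrK) (toNat ξ)
        · exact gtRaise_pow_gtVec_eq_zero (by omega) (ξ.2.gtStage hKn hrK)
            (gtStage_room ξ.2 hKn hrK) (toNat ξ) hd'
        · by_cases hlast : K' = K ∧ r' = r + 1
          · obtain ⟨rfl, rfl⟩ := hlast
            have := congrArg (fun x : ℕ => (x : ℤ)) hrel.2
            simpa only [Int.toNat_of_nonneg (ξ.2.gtGap_nonneg hKn hrK),
              Int.toNat_of_nonneg (η.2.gtGap_nonneg hKn hrK)] using this
          · exact hrel.1 K' r' h1 (by omega)
    refine (down K le_rfl).mono (fun ξ => ?_) (fun ξ η hrel K' r' h1 h2 => ?_)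
    · rw [Nat.sub_self, gtStage_succ]
    · rcases Nat.eq_zero_or_pos r' with rfl | hpos
      · simp [gtGap]
      · exact hrel K' r' h1 (by omega)

/-- A product of raising operators that singles out one pattern of the support of a vector. -/
theorem exists_raising (hm : Antitone m) {G : Submonoid (Module.End ℂ (GTSpace m))}
    (hG : ∀ k, 1 ≤ k → k < n → gtRaise m k ∈ G) {v : GTSpace m} (hv : v ≠ 0) :
    ∃ T ∈ G, ∃ ξ ∈ v.support, ∃ c : ℂ, c ≠ 0 ∧
      T (Finsupp.single ξ 1) = c • (Finsupp.single (gtHighest m hm) 1 : GTSpace m) ∧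
      (∀ η ∈ v.support, η ≠ ξ → T (Finsupp.single η 1) = 0) ∧
      T v = (v ξ * c) • (Finsupp.single (gtHighest m hm) 1 : GTSpace m) := by
  obtain ⟨T, hT, S', hS', ⟨ξ, hξ⟩, hsel, hkill, hrel⟩ :=
    selects_gtStage hG (Finsupp.support_nonempty_iff.2 hv) le_rfl
  obtain ⟨c, hc, hce⟩ := hsel ξ hξ
  have uniq : ∀ η ∈ S', η = ξ := fun η hη => Subtype.ext <|
    η.2.eq_of_gtGap ξ.2 fun K r hK hr => hrel η hη ξ hξ K r hr (Or.inl hK)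
  have hTξ : T (Finsupp.single ξ 1) =
      (c : ℂ) • (Finsupp.single (gtHighest m hm) 1 : GTSpace m) := by
    rw [hce]
    beta_reduce
    rw [gtStage_last ξ.2]
    exact congrArg _ (gtVec_val (gtHighest m hm))
  have hTη : ∀ η ∈ v.support, η ≠ ξ → T (Finsupp.single η 1) = 0 :=
    fun η hη hne => hkill η hη fun h => hne (uniq η h)
  refine ⟨T, hT, ξ, hS' hξ, c, Complex.ofReal_ne_zero.2 hc.ne', hTξ, hTη, ?_⟩
  have expand : v = ∑ η ∈ v.support, v η • Finsupp.single η (1 : ℂ) := by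
    conv_lhs => rw [← Finsupp.sum_single v]
    exact Finset.sum_congr rfl fun η _ => by simp
  conv_lhs => rw [expand]
  rw [map_sum, Finset.sum_eq_single ξ]
  · rw [map_smul, hTξ, smul_smul]
  · intro η hη hne
    rw [map_smul, hTη η hη hne, smul_zero]
  · intro h; exact absurd (hS' hξ) h

end Raising

/-! ### Duality and the structure of the module -/

section Duality

variable {n : ℕ} {m : Fin n → ℤ}

/-- The bilinear form for which the patterns are an orthonormal basis. -/
noncomputable def gtForm (m : Fin n → ℤ) : GTSpace m →ₗ[ℂ] GTSpace m →ₗ[ℂ] ℂ :=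
  Finsupp.linearCombination ℂ fun ξ => Finsupp.lapply ξ

theorem gtForm_single (ξ : GTPattern m) (x : GTSpace m) :
    gtForm m (Finsupp.single ξ 1) x = x ξ := by
  simp [gtForm]

theorem gtForm_gtVec_gtVec {p q : ℕ → ℕ → ℤ} (hp : IsGTPattern m p) [Decidable (p = q)] :
    gtForm m (gtVec m p) (gtVec m q) = if p = q then 1 else 0 := by
  by_cases hq : IsGTPattern m q
  · rw [gtVec_val ⟨p, hp⟩, gtForm_single, gtVec_val ⟨q, hq⟩]
    by_cases h : p = q
    · subst h; simp
    · rw [if_neg h, Finsupp.single_eq_of_ne]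
      exact fun hc => h (congrArg Subtype.val hc)
  · rw [gtVec_of_not hq, map_zero, if_neg]
    rintro rfl
    exact hq hp

theorem gtForm_comm (x y : GTSpace m) : gtForm m x y = gtForm m y x := by
  classical
  have : gtForm m = (gtForm m).flip := by
    refine hom_ext_gtVec fun p hp => hom_ext_gtVec fun q hq => ?_
    rw [LinearMap.flip_apply, gtForm_gtVec_gtVec hp, gtForm_gtVec_gtVec hq]
    simp only [eq_comm]
  conv_lhs => rw [this]
  rfl

/-- The raising and lowering operators are adjoint to each other. -/
theorem gtForm_gtRaise {k : ℕ} (hk : 1 ≤ k) (x y : GTSpace m) :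
    gtForm m (gtRaise m k x) y = gtForm m x (gtLower m k y) := by
  classical
  have : gtForm m ∘ₗ gtRaise m k = (gtForm m).compl₂ (gtLower m k) := by
    refine hom_ext_gtVec fun p hp => hom_ext_gtVec fun q hq => ?_
    rw [LinearMap.comp_apply, LinearMap.compl₂_apply, gtRaise_gtVec hp, gtLower_gtVec hq,
      gtForm_comm, map_sum, map_sum]
    refine Finset.sum_congr rfl fun j _ => ?_
    rw [map_smul, map_smul, gtForm_gtVec_gtVec hq, gtForm_gtVec_gtVec hp]
    by_cases h : q = gtShift p k j 1
    · have h' : p = gtShift q k j (-1) := by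
        rw [h, gtShift_gtShift_neg _ _ _ _ _ (by norm_num)]
      rw [if_pos h, if_pos h']
      congr 2
      change √(raiseSq p k j) = √(lowerSq q k j)
      rw [h, lowerSq_gtShift_one p hk]
    · rw [if_neg h, if_neg, smul_zero, smul_zero]
      rintro rfl
      exact h (by rw [gtShift_gtShift_neg _ _ _ _ _ (by norm_num)])
  exact LinearMap.congr_fun (LinearMap.congr_fun this x) y

end Duality

section Action

variable {n : ℕ} {m : Fin n → ℤ} [LieRingModule (SLn n) (GTSpace m)]

theorem IsGTAction.toEnd_slUnit_raise [LieModule ℂ (SLn n) (GTSpace m)] (hA : IsGTAction m)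
    {i j : Fin n} (h : i ≠ j) (hij : (i : ℕ) + 1 = j) :
    LieModule.toEnd ℂ (SLn n) (GTSpace m) (slUnit i j h) = gtRaise m j :=
  LinearMap.ext fun v => hA.raise i j h hij v

theorem IsGTAction.toEnd_slUnit_lower [LieModule ℂ (SLn n) (GTSpace m)] (hA : IsGTAction m)
    {i j : Fin n} (h : j ≠ i) (hij : (i : ℕ) + 1 = j) :
    LieModule.toEnd ℂ (SLn n) (GTSpace m) (slUnit j i h) = gtLower m j :=
  LinearMap.ext fun v => hA.lower i j h hij v

variable [LieModule ℂ (SLn n) (GTSpace m)]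

theorem IsGTAction.gtRaise_mem (hA : IsGTAction m) {k : ℕ} (hk : 1 ≤ k) (hkn : k < n) :
    gtRaise m k ∈ raisingProducts n (GTSpace m) := by
  have hne : (⟨k - 1, by omega⟩ : Fin n) ≠ ⟨k, hkn⟩ := by
    intro h
    have := congrArg Fin.val h
    simp only at this
    omega
  have hsucc : k - 1 + 1 = k := by omega
  exact Submonoid.subset_closure
    ⟨⟨k - 1, by omega⟩, ⟨k, hkn⟩, hne, hsucc, (hA.toEnd_slUnit_raise hne hsucc).symm⟩

/-- The adjoint of a product of raising operators is a product of lowering operators. -/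
theorem IsGTAction.exists_adjoint (hA : IsGTAction m) {T : Module.End ℂ (GTSpace m)}
    (hT : T ∈ raisingProducts n (GTSpace m)) :
    ∃ T' ∈ loweringProducts n (GTSpace m), ∀ x y, gtForm m (T x) y = gtForm m x (T' y) := by
  induction hT using Submonoid.closure_induction with
  | mem T hT =>
    obtain ⟨i, j, h, hij, rfl⟩ := hT
    refine ⟨_, Submonoid.subset_closure ⟨i, j, h.symm, hij, rfl⟩, fun x y => ?_⟩
    rw [hA.toEnd_slUnit_raise h hij, hA.toEnd_slUnit_lower h.symm hij, gtForm_gtRaise (by omega)]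
  | one => exact ⟨1, Submonoid.one_mem _, fun x y => rfl⟩
  | mul S T _ _ ihS ihT =>
    obtain ⟨S', hS', hS⟩ := ihS
    obtain ⟨T', hT', hT⟩ := ihT
    refine ⟨T' * S', Submonoid.mul_mem _ hT' hS', fun x y => ?_⟩
    rw [Module.End.mul_apply, Module.End.mul_apply, hS, hT]

/-- A linear functional is the pairing with a vector `v`.  If it vanished on everything that the
lowering operators make of the highest pattern, no product of raising operators could send `v` to a
nonzero multiple of the highest pattern. -/
theorem IsGTAction.span_lowering (hA : IsGTAction m) (hm : Antitone m) :
    Submodule.span ℂ {u : GTSpace m | ∃ T ∈ loweringProducts n (GTSpace m),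
      u = T (Finsupp.single (gtHighest m hm) 1)} = ⊤ := by
  by_contra hne
  obtain ⟨φ, hφ, hle⟩ := Submodule.exists_le_ker_of_lt_top _ (lt_top_iff_ne_top.2 hne)
  let v : GTSpace m := Finsupp.equivFunOnFinite.symm fun ξ => φ (Finsupp.single ξ 1)
  have hv : ∀ x, gtForm m v x = φ x := by
    intro x
    have : gtForm m v = φ := by
      refine hom_ext_gtVec fun p hp => ?_
      rw [gtForm_comm, gtVec_val ⟨p, hp⟩, gtForm_single]
      rfl
    rw [this]
  have hv0 : v ≠ 0 := by
    intro h0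
    exact hφ (LinearMap.ext fun x => by rw [← hv, h0]; simp)
  obtain ⟨T, hT, ξ, hξ, c, hc, -, -, hTv⟩ :=
    exists_raising hm (fun k hk hkn => hA.gtRaise_mem hk hkn) hv0
  obtain ⟨T', hT', hadj⟩ := hA.exists_adjoint hT
  have h1 := hadj v (Finsupp.single (gtHighest m hm) 1)
  have h2 : φ (T' (Finsupp.single (gtHighest m hm) 1)) = 0 :=
    hle (Submodule.subset_span ⟨T', hT', rfl⟩)
  rw [hTv, map_smul, LinearMap.smul_apply, gtForm_single, hv, h2, Finsupp.single_eq_same,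
    smul_eq_mul, mul_one] at h1
  exact mul_ne_zero (Finsupp.mem_support_iff.1 hξ) hc h1

theorem map_mem_of_mem_closure {M : Type*} [AddCommGroup M] [Module ℂ M]
    [LieRingModule (SLn n) M] [LieModule ℂ (SLn n) M] (N : LieSubmodule ℂ (SLn n) M)
    {s : Set (Module.End ℂ M)} (hs : ∀ T ∈ s, ∃ x, T = LieModule.toEnd ℂ (SLn n) M x)
    {T : Module.End ℂ M} (hT : T ∈ Submonoid.closure s) {v : M} (hv : v ∈ N) : T v ∈ N := by
  induction hT using Submonoid.closure_induction generalizing v with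
  | mem T hT =>
    obtain ⟨x, rfl⟩ := hs T hT
    exact N.lie_mem hv
  | one => exact hv
  | mul S T _ _ ihS ihT => exact ihS (ihT hv)

theorem IsGTAction.isIrreducible (hA : IsGTAction m) (hm : Antitone m) :
    LieModule.IsIrreducible ℂ (SLn n) (GTSpace m) := by
  have : Nontrivial (GTSpace m) :=
    ⟨Finsupp.single (gtHighest m hm) 1, 0, by simp⟩
  refine LieModule.IsIrreducible.mk fun N hN => ?_
  obtain ⟨v, hvN, hv0⟩ := N.toSubmodule.ne_bot_iff.1 (mt (LieSubmodule.toSubmodule_eq_bot N).1 hN)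
  obtain ⟨T, hT, ξ, hξ, c, hc, -, -, hTv⟩ :=
    exists_raising hm (fun k hk hkn => hA.gtRaise_mem hk hkn) hv0
  have hβ : Finsupp.single (gtHighest m hm) 1 ∈ N := by
    have h1 : T v ∈ N := map_mem_of_mem_closure N
      (by rintro _ ⟨i, j, h, -, rfl⟩; exact ⟨_, rfl⟩) hT hvN
    rw [hTv] at h1
    have h2 := N.smul_mem (v ξ * c)⁻¹ h1
    rwa [smul_smul, inv_mul_cancel₀ (mul_ne_zero (Finsupp.mem_support_iff.1 hξ) hc),
      one_smul] at h2
  rw [← LieSubmodule.toSubmodule_inj, LieSubmodule.top_toSubmodule, eq_top_iff,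
    ← hA.span_lowering hm, Submodule.span_le]
  rintro _ ⟨T', hT', rfl⟩
  exact map_mem_of_mem_closure N (by rintro _ ⟨i, j, h, -, rfl⟩; exact ⟨_, rfl⟩) hT' hβ

end Action

section HighestWeight

variable {n : ℕ} {m : Fin n → ℤ}

attribute [local instance 100] LieRing.ofAssociativeRing

theorem gtRaise_gtHighest (hm : Antitone m) {k : ℕ} (hk : k < n) :
    gtRaise m k (Finsupp.single (gtHighest m hm) 1) = 0 := by
  rw [← gtVec_val]
  refine gtRaise_eq_zero_of_filled hk fun j hj => ?_
  change gtHighestArray m k j = gtHighestArray m (k + 1) j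
  rw [gtHighestArray, dif_pos ⟨hk.le, hj⟩, gtHighestArray, dif_pos ⟨hk, by omega⟩]

theorem gtRep_upper_gtHighest (hm : Antitone m) {i j : Fin n} (hij : i < j) :
    gtRep m (Matrix.single i j 1) (Finsupp.single (gtHighest m hm) 1) = 0 := by
  have hlt : (i : ℕ) < j := hij
  obtain ⟨d, hd⟩ : ∃ d, (j : ℕ) = i + d + 1 := ⟨j - i - 1, by omega⟩
  rw [gtRep, unitVectorMap_single, hd, unitVector_add]
  exact rootVector_apply_eq_zero fun k hk => gtRaise_gtHighest hm (by omega)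

theorem gtRep_isDiag_apply {A : Matrix (Fin n) (Fin n) ℂ} (hA : A.IsDiag) (ξ : GTPattern m) :
    gtRep m A (Finsupp.single ξ 1) =
      (∑ i, A i i * gtWeight ξ.1 i) • (Finsupp.single ξ 1 : GTSpace m) := by
  have : A = ∑ i, A i i • Matrix.single i i (1 : ℂ) := by
    conv_lhs => rw [← hA.diagonal_diag, ← Matrix.sum_single_eq_diagonal]
    simp
  rw [this, map_sum, LinearMap.sum_apply, Finset.sum_smul, ← this]
  refine Finset.sum_congr rfl fun i _ => ?_
  rw [map_smul, gtRep_single_self, LinearMap.smul_apply, ← gtVec_val, gtDiag_gtVec, smul_smul]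

/-- The action of `sl_n` on the space of patterns. -/
@[reducible] noncomputable def gtLieRingModule (m : Fin n → ℤ) :
    LieRingModule (SLn n) (GTSpace m) where
  bracket x v := gtLieHom m x v
  add_lie x y v := by rw [map_add, LinearMap.add_apply]
  lie_add x v w := (gtLieHom m x).map_add v w
  leibniz_lie x y v := by
    rw [LieHom.map_lie, LieRing.of_associative_ring_bracket, LinearMap.sub_apply,
      Module.End.mul_apply, Module.End.mul_apply, sub_add_cancel]

end HighestWeight

theorem theorem5p1p1 (n : ℕ) (m : Fin n → ℤ) (hm : Antitone m) :
    ∃ (_ : LieRingModule (SLn n) (GTSpace m)) (_ : LieModule ℂ (SLn n) (GTSpace m)),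
      IsGTAction m ∧
      LieModule.IsIrreducible ℂ (SLn n) (GTSpace m) ∧
      IsHighestWeightVector (n := n) (Finsupp.single (gtHighest m hm) 1 : GTSpace m) ∧
      (∀ v : GTSpace m, v ≠ 0 →
        ∃ T ∈ raisingProducts n (GTSpace m), ∃ ξ ∈ v.support, ∃ c : ℂ, c ≠ 0 ∧
          T (Finsupp.single ξ 1) = c • (Finsupp.single (gtHighest m hm) 1 : GTSpace m) ∧
          (∀ η ∈ v.support, η ≠ ξ → T (Finsupp.single η 1) = 0) ∧
          T v = (v ξ * c) • (Finsupp.single (gtHighest m hm) 1 : GTSpace m)) ∧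
      Submodule.span ℂ {u : GTSpace m | ∃ T ∈ loweringProducts n (GTSpace m),
        u = T (Finsupp.single (gtHighest m hm) 1)} = ⊤ := by
  let _ : LieRingModule (SLn n) (GTSpace m) := gtLieRingModule m
  have lie_eq : ∀ (x : SLn n) (v : GTSpace m), ⁅x, v⁆ = gtRep m x.1 v := fun _ _ => rfl
  have _ : LieModule ℂ (SLn n) (GTSpace m) :=
    { smul_lie := fun c x v => by
        rw [lie_eq, lie_eq, ← LinearMap.smul_apply, ← map_smul]
        rfl
      lie_smul := fun c x v => by rw [lie_eq, lie_eq, map_smul] }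
  have hA : IsGTAction m :=
    { raise := fun i j h hij v => by
        rw [lie_eq, ← gtRep_single_succ m hij]
        rfl
      lower := fun i j h hij v => by
        rw [lie_eq, ← gtRep_succ_single m hij]
        rfl
      diag := fun i j hij v => by
        rw [lie_eq, ← gtRep_single_self, ← gtRep_single_self, ← LinearMap.sub_apply,
          ← map_sub (gtRep m)]
        rfl }
  exact ⟨_, inferInstance, hA, hA.isIrreducible hm,
    ⟨by simp, fun x hx => ⟨_, (lie_eq _ _).trans (gtRep_isDiag_apply hx _)⟩,
      fun i j h hij => (lie_eq _ _).trans (gtRep_upper_gtHighest hm hij)⟩,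
    fun v hv => exists_raising hm (fun k hk hkn => hA.gtRaise_mem hk hkn) hv, hA.span_lowering hm⟩
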